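/- **Theorem 4.5 (The relationship between the condition numbers).** Let $T\in\mathbb R^{m\times n}$, $n\ge 1$, have rank $n$. Write $\|A\|_2$ for the spectral norm, $\|A\|_g$ for the largest Euclidean norm of a column of $A$, $\sigma_{\min}(A)$ for the $n$-th singular value of a matrix $A$ with $n$ columns, and $\kappa_2(A)=\|A\|_2/\sigma_{\min}(A)$ if $A$ has full column rank. *Algorithms.* CholeskyQR$(A)$ computes $U=A^{\top}A$, the upper triangular Cholesky factor $V$ of $U$, and $Q=AV^{-1}$ (by substitution, row by row). Shifted CholeskyQR$(T)$ with shift $s$ does the same with $U+sI$ in place of $U=T^\top T$ in the Cholesky step and returns $[Q,V]$. Shifted CholeskyQR3 runs $[Q,V]=$ Shifted CholeskyQR$(T)$, $[Q_1,V_1]=$ CholeskyQR$(Q)$, $V_2=V_1V$, $[Q_2,V_3]=$ CholeskyQR$(Q_1)$, $V_4=V_3V_2$. A run completes if no Cholesky factorization in it breaks down, i.e. every number of which a square root is taken is positive. All algorithms are executed in floating-point arithmetic with unit roundoff $\mathbf u>0$: every elementary operation returns its exact result times $1+\delta$, where the $\delta$'s of all the operations are independent random variables of mean zero with $|\delta|\le\mathbf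 u$ almost surely; sums are accumulated from left to right. *Settings.* Let $0<\lambda\le 10$, $P(\lambda)=1-2\exp\!\big(-\tfrac{\lambda^2(1-\mathbf u)^2}{2}\big)$, $\mathcal Q(\lambda,N)=1-N(1-P(\lambda))$, and suppose that $$\max(\lambda\sqrt m\,n\mathbf u,\;mn\mathbf u)\le\tfrac1{2200},\qquad \max(\lambda\sqrt{n+1}\,n\mathbf u,\;n(n+1)\mathbf u)\le\tfrac1{2200},$$ and that $\mathcal Q(\lambda,mn^2)$, $\mathcal Q(\lambda,\tfrac{n^3}6+\tfrac{n^2}2+\tfrac n3)$ and $\mathcal Q(\lambda,\tfrac{n(n+1)}2)$ are positive. Put $$S=\sqrt m\,n\mathbf u+\sqrt{n+1}\,n\mathbf u,\qquad s=11\lambda S\|T\|_g^2,\qquad t=\frac{s}{\|T\|_2^2},\qquad p_1=\frac{\|T\|_g}{\|T\|_2},\qquad p_2=\frac{\|Q\|_g}{\|Q\|_2},$$ where $Q$ is the computed (random) factor of Shifted CholeskyQR$(T)$ with the shift $s$. *Conclusion.* One has $t=11p_1^2\lambda S$, and with probability at least $$\Big(\mathcal Q(\lambda,mn^2)\,\mathcal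 Q\big(\lambda,\tfrac{n^3}6+\tfrac{n^2}2+\tfrac n3\big)\Big)^2\,\mathcal Q\big(\lambda,\tfrac{n(n+1)}2\big)$$ Shifted CholeskyQR$(T)$ completes and both of the following hold. 1. If $4.89\,p_1p_2\lambda n\sqrt n\,\mathbf u\,\kappa_2(T)\le 1$, then $Q$ has rank $n$, $$\kappa_2(Q)\le 3.24\sqrt{1+t\,\kappa_2(T)^2},$$ and, if in addition $t\,\kappa_2(T)^2\ge 1$ (that is, $T$ is ill-conditioned: $\sigma_{\min}(T)^2\le s$), $$\kappa_2(Q)\le 3.24\sqrt t\;\kappa_2(T).$$ 2. One has $\dfrac1{86\lambda p_1p_2S}\le\dfrac1{4.89\lambda p_1p_2n\sqrt n\,\mathbf u}$, and if $$\kappa_2(T)\le\frac1{86\lambda p_1p_2(\sqrt m\,n\mathbf u+\sqrt{n+1}\,n\mathbf u)},$$ then Shifted CholeskyQR3 works: $Q$ has rank $n$ and satisfies the condition $8p_2\,\kappa_2(Q)\sqrt{\lambda S}\le1$ for applying CholeskyQR2 to it, and the whole run of Shifted CholeskyQR3 completes. -/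

import Mathlib

open MeasureTheory ProbabilityTheory

section Norms

/-- The spectral norm `‖A‖₂` of a real matrix. -/
noncomputable def norm2 {m n : ℕ} (A : Matrix (Fin m) (Fin n) ℝ) : ℝ :=
  ‖(Matrix.toEuclideanLin A).toContinuousLinearMap‖

/-- The `g`-norm `‖A‖_g`: the largest Euclidean norm of a column of `A`. -/
noncomputable def gNorm {m n : ℕ} (A : Matrix (Fin m) (Fin n) ℝ) : ℝ :=
  ⨆ j : Fin n, √(∑ i : Fin m, A i j ^ 2)

/-- The smallest singular value `σ_n(A)` of a matrix with `n` columns (singular values are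
indexed from zero and sorted in decreasing order). -/
noncomputable def sigmaMin {m n : ℕ} (A : Matrix (Fin m) (Fin n) ℝ) : ℝ :=
  (Matrix.toEuclideanLin A).singularValues (n - 1)

/-- The spectral condition number `κ₂(A) = ‖A‖₂ / σ_min(A)` of a matrix of full column rank. -/
noncomputable def kappa2 {m n : ℕ} (A : Matrix (Fin m) (Fin n) ℝ) : ℝ :=
  norm2 A / sigmaMin A

/-- The ratio `p = ‖A‖_g / ‖A‖₂`. -/
noncomputable def pRatio {m n : ℕ} (A : Matrix (Fin m) (Fin n) ℝ) : ℝ :=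
  gNorm A / norm2 A

end Norms

section Floating

/-- Labels of the elementary floating-point operations. `step` numbers the matrix computations
of an algorithm in the order of their execution; the other arguments say for which entry
(and, inside a sum, for which term) the operation is carried out. -/
inductive FlOp : Type where
  | mul (step i j k : ℕ) : FlOp
  | add (step i j k : ℕ) : FlOp
  | div (step i j : ℕ) : FlOp
  | sqrt (step i : ℕ) : FlOp

/-- Computed inner product `∑_{k < N} x k * y k`, accumulated from left to right. The product
number `k` has the relative error `d k`, its addition to the partial sum has the relative
error `e k`. -/
noncomputable def flDot (d e x y : ℕ → ℝ) : ℕ → ℝ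
  | 0 => 0
  | 1 => x 0 * y 0 * (1 + d 0)
  | k + 2 => (flDot d e x y (k + 1) + x (k + 1) * y (k + 1) * (1 + d (k + 1))) * (1 + e (k + 1))

/-- Computed value of `a - ∑_{k < N} x k * y k`, the products being subtracted one after the
other. -/
noncomputable def flSubDot (d e : ℕ → ℝ) (a : ℝ) (x y : ℕ → ℝ) : ℕ → ℝ
  | 0 => a
  | k + 1 => (flSubDot d e a x y k - x k * y k * (1 + d k)) * (1 + e k)

/-- A matrix as a doubly indexed array, padded with zeros. -/
noncomputable def toArr {m n : ℕ} (A : Matrix (Fin m) (Fin n) ℝ) (i j : ℕ) : ℝ :=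
  if h : i < m ∧ j < n then A ⟨i, h.1⟩ ⟨j, h.2⟩ else 0

/-- Computed matrix product. Every operation `o` has the relative error `δ o`. -/
noncomputable def flMatMul (δ : FlOp → ℝ) (step : ℕ) {m p n : ℕ}
    (A : Matrix (Fin m) (Fin p) ℝ) (B : Matrix (Fin p) (Fin n) ℝ) : Matrix (Fin m) (Fin n) ℝ :=
  Matrix.of fun i j =>
    flDot (fun k => δ (.mul step i j k)) (fun k => δ (.add step i j k))
      (fun k => toArr A i k) (fun k => toArr B k j) p

/-- Computed sum `U + s I`. -/
noncomputable def flShift (δ : FlOp → ℝ) (step : ℕ) (s : ℝ) {n : ℕ}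
    (U : Matrix (Fin n) (Fin n) ℝ) : Matrix (Fin n) (Fin n) ℝ :=
  Matrix.of fun i j => if i = j then (U i i + s) * (1 + δ (.add step i i 0)) else U i j

/-- The computed value of `A i j - ∑_{k < i} V k i * V k j` in Cholesky factorization. -/
noncomputable def flCholReduced (δ : FlOp → ℝ) (step : ℕ) (A V : ℕ → ℕ → ℝ) (i j : ℕ) : ℝ :=
  flSubDot (fun k => δ (.mul step i j k)) (fun k => δ (.add step i j k)) (A i j)
    (fun k => V k i) (fun k => V k j) i

/-- The first `N` computed rows of the upper triangular Cholesky factor of the array `A`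
(the other rows are zero). Only the diagonal and the upper triangle of `A` are used. -/
noncomputable def flCholRows (δ : FlOp → ℝ) (step : ℕ) (A : ℕ → ℕ → ℝ) : ℕ → ℕ → ℕ → ℝ
  | 0 => fun _ _ => 0
  | i + 1 => fun r c =>
      let V := flCholRows δ step A i
      let diag := √(flCholReduced δ step A V i i) * (1 + δ (.sqrt step i))
      if r = i then
        if c < i then 0
        else if c = i then diag
        else flCholReduced δ step A V i c / diag * (1 + δ (.div step i c))
      else V r c

/-- Computed upper triangular Cholesky factor. -/
noncomputable def flCholesky (δ : FlOp → ℝ) (step : ℕ) {n : ℕ}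
    (A : Matrix (Fin n) (Fin n) ℝ) : Matrix (Fin n) (Fin n) ℝ :=
  Matrix.of fun i j => flCholRows δ step (toArr A) n i j

/-- The computed Cholesky factorization of `A` does not break down: every number of which a
square root is taken is positive. -/
def FlCholeskyCompletes (δ : FlOp → ℝ) (step : ℕ) {n : ℕ}
    (A : Matrix (Fin n) (Fin n) ℝ) : Prop :=
  ∀ i < n, 0 < flCholReduced δ step (toArr A) (flCholRows δ step (toArr A) i) i i

/-- The first `N` computed entries (the others are zero) of the row number `r` of `T V⁻¹`,
by substitution in the triangular system `q V = t`, where `t` is the row number `r` of `T`. -/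
noncomputable def flSolveRow (δ : FlOp → ℝ) (step : ℕ) (T V : ℕ → ℕ → ℝ) (r : ℕ) :
    ℕ → ℕ → ℝ
  | 0 => fun _ => 0
  | j + 1 => fun c =>
      let q := flSolveRow δ step T V r j
      if c = j then
        flSubDot (fun k => δ (.mul step r j k)) (fun k => δ (.add step r j k)) (T r j)
          q (fun k => V k j) j / V j j * (1 + δ (.div step r j))
      else q c

/-- Computed `T V⁻¹` for an upper triangular `V`, one triangular system for every row. -/
noncomputable def flSolve (δ : FlOp → ℝ) (step : ℕ) {m n : ℕ}
    (T : Matrix (Fin m) (Fin n) ℝ) (V : Matrix (Fin n) (Fin n) ℝ) : Matrix (Fin m) (Fin n) ℝ :=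
  Matrix.of fun i j => flSolveRow δ step (toArr T) (toArr V) i n j

/-- The outcome of a run of a QR algorithm in floating-point arithmetic: whether the run
completes without numerical breakdown, and the two computed factors (which are meaningful
only if it does). -/
structure FlQR (m n : ℕ) where
  completes : Prop
  Q : Matrix (Fin m) (Fin n) ℝ
  V : Matrix (Fin n) (Fin n) ℝ

/-- CholeskyQR in floating-point arithmetic; its three steps have the numbers
`b`, `b + 1`, `b + 2`. -/
noncomputable def flCholeskyQR (δ : FlOp → ℝ) (b : ℕ) {m n : ℕ}
    (T : Matrix (Fin m) (Fin n) ℝ) : FlQR m n :=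
  let U := flMatMul δ b T.transpose T
  let V := flCholesky δ (b + 1) U
  { completes := FlCholeskyCompletes δ (b + 1) U
    Q := flSolve δ (b + 2) T V
    V := V }

/-- Shifted CholeskyQR with the shift `s` in floating-point arithmetic; its four steps have the
numbers `0`, `1`, `2`, `3`. -/
noncomputable def flSCholeskyQR (δ : FlOp → ℝ) (s : ℝ) {m n : ℕ}
    (T : Matrix (Fin m) (Fin n) ℝ) : FlQR m n :=
  let U := flMatMul δ 0 T.transpose T
  let U' := flShift δ 1 s U
  let V := flCholesky δ 2 U'
  { completes := FlCholeskyCompletes δ 2 U'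
    Q := flSolve δ 3 T V
    V := V }

/-- Shifted CholeskyQR3 in floating-point arithmetic: Shifted CholeskyQR (steps `0` to `3`),
CholeskyQR (steps `4` to `6`), the product `V₂ = V₁ V` (step `7`), CholeskyQR (steps `8` to
`10`), the product `V₄ = V₃ V₂` (step `11`). -/
noncomputable def flSCholeskyQR3 (δ : FlOp → ℝ) (s : ℝ) {m n : ℕ}
    (T : Matrix (Fin m) (Fin n) ℝ) : FlQR m n :=
  let R := flSCholeskyQR δ s T
  let R₁ := flCholeskyQR δ 4 R.Q
  let V₂ := flMatMul δ 7 R₁.V R.V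
  let R₂ := flCholeskyQR δ 8 R₁.Q
  { completes := R.completes ∧ R₁.completes ∧ R₂.completes
    Q := R₂.Q
    V := flMatMul δ 11 R₂.V V₂ }

/-- The probabilistic model of rounding errors: the relative errors of the elementary
operations are independent random variables of mean zero, bounded in absolute value by the unit
roundoff `u`. -/
structure IsRoundingModel {Ω : Type*} [MeasurableSpace Ω] (μ : Measure Ω) (u : ℝ)
    (δ : FlOp → Ω → ℝ) : Prop where
  measurable : ∀ o, Measurable (δ o)
  indep : iIndepFun δ μ
  mean_zero : ∀ o, ∫ ω, δ o ω ∂μ = 0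
  bounded : ∀ o, ∀ᵐ ω ∂μ, |δ o ω| ≤ u

/-- `P(λ) = 1 - 2 exp(-λ² (1 - u)² / 2)`. -/
noncomputable def probP (u lam : ℝ) : ℝ :=
  1 - 2 * Real.exp (-(lam ^ 2 * (1 - u) ^ 2) / 2)

/-- `Q(λ, N) = 1 - N (1 - P(λ))`. -/
noncomputable def probQ (u lam N : ℝ) : ℝ :=
  1 - N * (1 - probP u lam)

end Floating

/-!
The computed quantities are perturbations of exact ones, and the perturbations are controlled by
sums of consecutive rounding errors of additions. The products that multiply the terms of a
computed inner product are, up to second order, `1` plus such a sum (`relNear_prod_one_add`).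
Since the errors are independent and of mean zero, Hoeffding's inequality
(`IsRoundingModel.measure_abs_sum_gt_le`) bounds a sum of `N` of them by `√2 λ √N u` instead of
`N u`. The deviation `√2 λ` in place of `λ` makes the tails of the order of the square of
`1 - P(λ)`, so that the union bound over all sums of the whole run stays below
`m n² (1 - P(λ))` (`probQ_le_one_sub_card_mul`); the first factor `Q(λ, m n²)` alone dominates the
claimed probability. The errors of multiplications, divisions and square roots are bounded by `u`.
They are not negligible against `√2 λ √N u` for small `N`, but positivity of the probability bound
forces `λ² > 2 log 2`, which absorbs them into slightly larger constants.

Everything else is deterministic. With `α = λ S`, one sweep on a matrix `A` with the shift `s`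
yields `V` and `Q` such that `‖V x‖²` differs from `‖A x‖² + s ‖x‖²` by at most
`2.3 α ‖A‖_g² ‖x‖²`, and `A - Q V` is small (`sweep_spec`). The factorization completes as soon as
`‖A x‖² + s ‖x‖² ≥ 10 α ‖A‖_g² ‖x‖²`: were a pivot not positive, the rows computed before it would
have a kernel vector, although their Gram matrix is close to a definite one
(`false_of_gram_close`). The shift `s = 11 α ‖T‖_g²` gives this condition for every `T`.

Substituting `z = V x` turns the two bounds into bounds of `‖Q z‖` in terms of `‖z‖`. The norm of
`Q` is at most `1.018` (`SweepBounds.norm2_le_of_shift`); from below, the residual costs at most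
`0.352 ‖A x‖`, and the shift costs the factor `√(1 + s / σ_min(A)²)`
(`SweepBounds.le_sigmaMin_of_shift`). Hence `κ₂(Q) ≤ 1.73 √(1 + t κ₂(T)²)`, which leaves room for
the factor `√2` that is lost when `1 + t κ₂(T)²` is replaced by `2 t κ₂(T)²`. If `κ₂(T)` is small
enough for CholeskyQR2, then `σ_min(Q)² ≥ 64 α ‖Q‖_g²`, the next sweep completes without a shift
and returns a nearly orthogonal matrix (`SweepBounds.nearly_orthogonal`), for which the last sweep
completes as well.
-/

/-! ### Products of rounding factors, and the error of computed sums -/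

/-- `x` lies within the factor `exp ρ` of `1`. -/
def RelNear (ρ x : ℝ) : Prop := Real.exp (-ρ) ≤ x ∧ x ≤ Real.exp ρ

namespace RelNear

variable {ρ σ x y u : ℝ}

lemma pos (h : RelNear ρ x) : 0 < x := (Real.exp_pos _).trans_le h.1

lemma mono (h : RelNear ρ x) (hρ : ρ ≤ σ) : RelNear σ x :=
  ⟨(Real.exp_le_exp.2 (neg_le_neg hρ)).trans h.1, h.2.trans (Real.exp_le_exp.2 hρ)⟩

lemma mul (hx : RelNear ρ x) (hy : RelNear σ y) : RelNear (ρ + σ) (x * y) := by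
  constructor
  · rw [neg_add, Real.exp_add]
    exact mul_le_mul hx.1 hy.1 (Real.exp_pos _).le hx.pos.le
  · rw [Real.exp_add]
    exact mul_le_mul hx.2 hy.2 hy.pos.le (Real.exp_pos _).le

lemma inv (hx : RelNear ρ x) : RelNear ρ x⁻¹ := by
  constructor
  · rw [Real.exp_neg]
    exact inv_anti₀ hx.pos hx.2
  · rw [← neg_neg ρ, Real.exp_neg]
    exact inv_anti₀ (Real.exp_pos _) hx.1

lemma abs_sub_one_le (hx : RelNear ρ x) (h0 : 0 ≤ ρ) (h1 : ρ ≤ 1 / 500) :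
    |x - 1| ≤ 1.002 * ρ := by
  have h2 := (abs_le.1 (Real.abs_exp_sub_one_sub_id_le
    (show |ρ| ≤ 1 by rw [abs_of_nonneg h0]; linarith))).2
  have h3 := Real.add_one_le_exp (-ρ)
  rw [abs_le]
  constructor
  · linarith [hx.1]
  · nlinarith [hx.2]

end RelNear

lemma exp_sub_le_one_add {e u : ℝ} (he : |e| ≤ u) (hu : u ≤ 1 / 5) :
    Real.exp (e - 2 * u ^ 2) ≤ 1 + e := by
  obtain ⟨h1, h2⟩ := abs_le.1 he
  have hsq : e ^ 2 ≤ u ^ 2 := sq_le_sq' h1 h2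
  have hle : Real.exp (e - 2 * u ^ 2) ≤ Real.exp (e - 2 * e ^ 2) :=
    Real.exp_le_exp.2 (by linarith)
  have hab : |e - 2 * e ^ 2| ≤ 1 := by
    rw [abs_le]; constructor <;> nlinarith
  have h3 := (abs_le.1 (Real.abs_exp_sub_one_sub_id_le hab)).2
  have h4 : e ^ 2 * (1 - 2 * e) ^ 2 ≤ e ^ 2 * 2 :=
    mul_le_mul_of_nonneg_left (by nlinarith) (sq_nonneg e)
  nlinarith

lemma relNear_one_add {e u : ℝ} (he : |e| ≤ u) (hu : u ≤ 1 / 5) :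
    RelNear (u + 2 * u ^ 2) (1 + e) := by
  obtain ⟨h1, h2⟩ := abs_le.1 he
  constructor
  · refine le_trans (Real.exp_le_exp.2 ?_) (exp_sub_le_one_add he hu)
    linarith
  · have := Real.add_one_le_exp e
    refine le_trans (by linarith) (Real.exp_le_exp.2 (show e ≤ u + 2 * u ^ 2 by nlinarith))

/-- A product of factors `1 + e l` is governed by the sum of the `e l`, not by the sum of their
absolute values. This is how cancellation between rounding errors enters. -/
lemma relNear_prod_one_add {ι : Type*} (s : Finset ι) {e : ι → ℝ} {u τ : ℝ}
    (he : ∀ l, |e l| ≤ u) (hu : u ≤ 1 / 5) (hτ : |∑ l ∈ s, e l| ≤ τ) :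
    RelNear (τ + s.card * (2 * u ^ 2)) (∏ l ∈ s, (1 + e l)) := by
  obtain ⟨h1, h2⟩ := abs_le.1 hτ
  constructor
  · calc Real.exp (-(τ + s.card * (2 * u ^ 2)))
        ≤ Real.exp (∑ l ∈ s, (e l - 2 * u ^ 2)) := by
          refine Real.exp_le_exp.2 ?_
          rw [Finset.sum_sub_distrib, Finset.sum_const, nsmul_eq_mul]
          linarith
      _ = ∏ l ∈ s, Real.exp (e l - 2 * u ^ 2) := Real.exp_sum _ _
      _ ≤ _ := Finset.prod_le_prod (fun _ _ => (Real.exp_pos _).le)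
          fun l _ => exp_sub_le_one_add (he l) hu
  · calc ∏ l ∈ s, (1 + e l) ≤ ∏ l ∈ s, Real.exp (e l) := by
          refine Finset.prod_le_prod (fun l _ => ?_) fun l _ => ?_
          · linarith [(abs_le.1 (he l)).1]
          · linarith [Real.add_one_le_exp (e l)]
      _ = Real.exp (∑ l ∈ s, e l) := (Real.exp_sum _ _).symm
      _ ≤ _ := Real.exp_le_exp.2 (by
          have : 0 ≤ s.card * (2 * u ^ 2) := by positivity
          linarith)

/-- The first addition is exact, hence the lower end `max k 1` of the interval of errors. -/
lemma flDot_eq_sum (d e x y : ℕ → ℝ) (N : ℕ) :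
    flDot d e x y N =
      ∑ k ∈ Finset.range N, x k * y k * ((1 + d k) * ∏ l ∈ Finset.Ico (max k 1) N, (1 + e l)) := by
  induction N with
  | zero => simp [flDot]
  | succ N ih =>
    cases N with
    | zero => simp [flDot]
    | succ N =>
      rw [flDot, ih, Finset.sum_range_succ _ (N + 1), add_mul, Finset.sum_mul]
      congr 1
      · refine Finset.sum_congr rfl fun k hk => ?_
        have hk' := Finset.mem_range.1 hk
        rw [Finset.prod_Ico_succ_top (show max k 1 ≤ N + 1 by omega)]
        ring
      · rw [show max (N + 1) 1 = N + 1 by omega]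
        simp
        ring

lemma flSubDot_eq_mul_sub (d e : ℕ → ℝ) (a : ℝ) (x y : ℕ → ℝ) (N : ℕ) (he : ∀ l, 0 < 1 + e l) :
    flSubDot d e a x y N = (∏ l ∈ Finset.range N, (1 + e l)) *
      (a - ∑ k ∈ Finset.range N,
        x k * y k * ((1 + d k) * (∏ l ∈ Finset.range k, (1 + e l))⁻¹)) := by
  induction N with
  | zero => simp [flSubDot]
  | succ N ih =>
    have hP : (∏ l ∈ Finset.range N, (1 + e l)) ≠ 0 :=
      Finset.prod_ne_zero_iff.2 fun l _ => (he l).ne'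
    rw [flSubDot, ih, Finset.prod_range_succ, Finset.sum_range_succ]
    field_simp
    ring

lemma flSubDot_congr (d e : ℕ → ℝ) (a : ℝ) {x y x' y' : ℕ → ℝ} {N : ℕ}
    (h : ∀ k < N, x k = x' k ∧ y k = y' k) :
    flSubDot d e a x y N = flSubDot d e a x' y' N := by
  induction N with
  | zero => rfl
  | succ N ih =>
    rw [flSubDot, flSubDot, ih fun k hk => h k (by omega), (h N (by omega)).1, (h N (by omega)).2]

/-- The error of a weighted sum whose weights are all near `1`. -/
lemma abs_sum_mul_sub_sum_le {N : ℕ} {z w : ℕ → ℝ} {γ : ℝ}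
    (hw : ∀ k < N, |w k - 1| ≤ γ) :
    |∑ k ∈ Finset.range N, z k * w k - ∑ k ∈ Finset.range N, z k| ≤
      γ * ∑ k ∈ Finset.range N, |z k| := by
  rw [← Finset.sum_sub_distrib, Finset.mul_sum]
  refine (Finset.abs_sum_le_sum_abs _ _).trans (Finset.sum_le_sum fun k hk => ?_)
  rw [show z k * w k - z k = (w k - 1) * z k by ring, abs_mul]
  exact mul_le_mul_of_nonneg_right (hw k (Finset.mem_range.1 hk)) (abs_nonneg _)

/-- Forward error of a computed inner product. -/
lemma abs_flDot_sub_le {d e x y : ℕ → ℝ} {N : ℕ} {γ : ℝ}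
    (hw : ∀ k < N, |(1 + d k) * ∏ l ∈ Finset.Ico (max k 1) N, (1 + e l) - 1| ≤ γ) :
    |flDot d e x y N - ∑ k ∈ Finset.range N, x k * y k| ≤
      γ * ∑ k ∈ Finset.range N, |x k * y k| := by
  rw [flDot_eq_sum]
  exact abs_sum_mul_sub_sum_le hw

/-- Backward error of one step of a substitution: the number computed from `a` and the first `N`
products determines the product number `N` up to the factor `h`. -/
lemma abs_sub_sum_le_of_flSubDot {d e x y : ℕ → ℝ} {a h : ℝ} {N : ℕ} {γ : ℝ}
    (he : ∀ l, 0 < 1 + e l) (hh : 0 < h)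
    (hlast : x N * y N = flSubDot d e a x y N * h)
    (hw : ∀ k < N, |(1 + d k) * (∏ l ∈ Finset.range k, (1 + e l))⁻¹ - 1| ≤ γ)
    (hwN : |(∏ l ∈ Finset.range N, (1 + e l))⁻¹ * h⁻¹ - 1| ≤ γ) :
    |a - ∑ k ∈ Finset.range (N + 1), x k * y k| ≤
      γ * ∑ k ∈ Finset.range (N + 1), |x k * y k| := by
  set P := ∏ l ∈ Finset.range N, (1 + e l) with hPdef
  have hP : 0 < P := Finset.prod_pos fun l _ => he l
  set w : ℕ → ℝ := fun k => if k < N then (1 + d k) * (∏ l ∈ Finset.range k, (1 + e l))⁻¹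
    else P⁻¹ * h⁻¹ with hwdef
  have key : a = ∑ k ∈ Finset.range (N + 1), x k * y k * w k := by
    rw [Finset.sum_range_succ]
    have h1 : ∑ k ∈ Finset.range N, x k * y k * w k = ∑ k ∈ Finset.range N,
        x k * y k * ((1 + d k) * (∏ l ∈ Finset.range k, (1 + e l))⁻¹) := by
      refine Finset.sum_congr rfl fun k hk => ?_
      simp [hwdef, Finset.mem_range.1 hk]
    have h2 : w N = P⁻¹ * h⁻¹ := by simp [hwdef]
    rw [h1, h2, hlast, flSubDot_eq_mul_sub d e a x y N he, ← hPdef]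
    field_simp
    ring
  have := abs_sum_mul_sub_sum_le (N := N + 1) (z := fun k => x k * y k) (w := w) (γ := γ) (by
    intro k hk
    by_cases hkN : k < N
    · simpa [hwdef, hkN] using hw k hkN
    · simpa [hwdef, hkN] using hwN)
  rw [← key] at this
  exact this

/-- If the number computed in `flSubDot` is not positive, neither is the corresponding exact
number with perturbed products. -/
lemma le_mul_sum_of_flSubDot_nonpos {d e x : ℕ → ℝ} {a : ℝ} {N : ℕ} {γ : ℝ}
    (he : ∀ l, 0 < 1 + e l) (hneg : flSubDot d e a x x N ≤ 0)
    (hw : ∀ k < N, |(1 + d k) * (∏ l ∈ Finset.range k, (1 + e l))⁻¹ - 1| ≤ γ) :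
    a ≤ (1 + γ) * ∑ k ∈ Finset.range N, x k * x k := by
  rw [flSubDot_eq_mul_sub d e a x x N he] at hneg
  have hP : 0 < ∏ l ∈ Finset.range N, (1 + e l) := Finset.prod_pos fun l _ => he l
  have h1 := nonpos_of_mul_nonpos_right hneg hP
  refine (sub_nonpos.1 h1).trans ?_
  rw [Finset.mul_sum]
  refine Finset.sum_le_sum fun k hk => ?_
  rw [mul_comm]
  exact mul_le_mul_of_nonneg_right (by linarith [(abs_le.1 (hw k (Finset.mem_range.1 hk))).2])
    (mul_self_nonneg _)

/-! ### Completion and backward error of the computed Cholesky factorization -/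

lemma sq_sum_range_le_mul_sum_sq (N : ℕ) (x : ℕ → ℝ) :
    (∑ r ∈ Finset.range N, |x r|) ^ 2 ≤ N * ∑ r ∈ Finset.range N, x r ^ 2 := by
  simpa using sq_sum_le_card_mul_sum_sq (s := Finset.range N) (f := fun r => |x r|)

/-- The quadratic form of a Gram matrix is a sum of squares. -/
lemma sum_sq_sum_eq_sum_sum (s t : Finset ℕ) (W : ℕ → ℕ → ℝ) (x : ℕ → ℝ) :
    ∑ k ∈ t, (∑ r ∈ s, W k r * x r) ^ 2 =
      ∑ r ∈ s, ∑ c ∈ s, x r * x c * ∑ k ∈ t, W k r * W k c := by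
  simp_rw [sq, Finset.sum_mul_sum, Finset.mul_sum]
  rw [Finset.sum_comm]
  refine Finset.sum_congr rfl fun r _ => ?_
  rw [Finset.sum_comm]
  exact Finset.sum_congr rfl fun c _ => Finset.sum_congr rfl fun k _ => by ring

lemma abs_sum_mul_le_sqrt_mul_sqrt (s : Finset ℕ) (x y : ℕ → ℝ) :
    ∑ k ∈ s, |x k * y k| ≤ √(∑ k ∈ s, x k * x k) * √(∑ k ∈ s, y k * y k) := by
  have := Real.sum_mul_le_sqrt_mul_sqrt s (fun k => |x k|) (fun k => |y k|)
  simpa [abs_mul, sq_abs, ← sq] using this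

/-- A linear system with fewer equations than unknowns has a nontrivial solution. -/
lemma exists_kernel_vector (W : ℕ → ℕ → ℝ) (i : ℕ) :
    ∃ x : ℕ → ℝ, 0 < ∑ r ∈ Finset.range (i + 1), x r ^ 2 ∧
      ∀ k < i, ∑ r ∈ Finset.range (i + 1), W k r * x r = 0 := by
  let A : Matrix (Fin (i + 1)) (Fin (i + 1)) ℝ :=
    Matrix.of fun k r => if (k : ℕ) < i then W k r else 0
  have hdet : A.det = 0 := by
    refine Matrix.det_eq_zero_of_row_eq_zero (Fin.last i) fun j => ?_
    simp [A]
  obtain ⟨v, hv0, hv⟩ := Matrix.exists_mulVec_eq_zero_iff.2 hdet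
  refine ⟨fun r => if h : r < i + 1 then v ⟨r, h⟩ else 0, ?_, fun k hk => ?_⟩
  · rw [← Fin.sum_univ_eq_sum_range (fun r => (if h : r < i + 1 then v ⟨r, h⟩ else 0) ^ 2)]
    obtain ⟨j, hj⟩ := Function.ne_iff.1 hv0
    have h0 : v j ≠ 0 := by simpa using hj
    refine Finset.sum_pos' (fun _ _ => sq_nonneg _) ⟨j, Finset.mem_univ _, ?_⟩
    simpa [j.is_lt, Nat.lt_succ_iff.1 j.is_lt] using sq_pos_of_ne_zero h0
  · rw [← Fin.sum_univ_eq_sum_range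
      (fun r => W k r * (if h : r < i + 1 then v ⟨r, h⟩ else 0))]
    have := congrFun hv ⟨k, by omega⟩
    simpa [A, Matrix.mulVec, dotProduct, hk, Nat.lt_succ_iff.1 (Fin.is_lt _)] using this

/-- The contradiction behind the completion of Cholesky factorization. If the pivot number `i`
fails, then the `i × (i + 1)` array `W` of the rows computed so far has a kernel vector, although
its Gram matrix `Wᵀ W` is close to a matrix `B` that is bounded below by `μ`. The column number
`i` of `W` is not bounded a priori; if it is long, its own diagonal entry pays for the errors it
causes. -/
lemma false_of_gram_close {i : ℕ} {W B : ℕ → ℕ → ℝ} {μ f γ H : ℝ} (hf : 0 ≤ f) (hγ : 0 ≤ γ)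
    (hγ' : γ ≤ 1 / 8) (hH : 0 ≤ H)
    (hB : ∀ x : ℕ → ℝ, μ * ∑ r ∈ Finset.range (i + 1), x r ^ 2 ≤
      ∑ r ∈ Finset.range (i + 1), ∑ c ∈ Finset.range (i + 1), x r * x c * B r c)
    (hoff : ∀ r ≤ i, ∀ c ≤ i, ¬ (r = i ∧ c = i) →
      |∑ k ∈ Finset.range i, W k r * W k c - B r c| ≤ f +
        γ * (√(∑ k ∈ Finset.range i, W k r * W k r) * √(∑ k ∈ Finset.range i, W k c * W k c)))
    (hdiag : B i i ≤ f + (1 + γ) * ∑ k ∈ Finset.range i, W k i * W k i)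
    (hcol : ∀ r < i, ∑ k ∈ Finset.range i, W k r * W k r ≤ 2 * H) (hBi : B i i ≤ H)
    (hμ : ((i : ℝ) + 1) * (f + 4 * γ * H) < μ) : False := by
  obtain ⟨x, hx0, hx⟩ := exists_kernel_vector W i
  set X := ∑ r ∈ Finset.range (i + 1), x r ^ 2 with hX
  set Z : ℕ → ℕ → ℝ := fun r c => ∑ k ∈ Finset.range i, W k r * W k c with hZ
  have hZnn : ∀ r, 0 ≤ Z r r := fun r => Finset.sum_nonneg fun k _ => mul_self_nonneg _
  have hzero : ∑ r ∈ Finset.range (i + 1), ∑ c ∈ Finset.range (i + 1), x r * x c * Z r c = 0 := by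
    rw [← sum_sq_sum_eq_sum_sum]
    exact Finset.sum_eq_zero fun k hk => by rw [hx k (Finset.mem_range.1 hk)]; simp
  have hBsum : ∑ r ∈ Finset.range (i + 1), ∑ c ∈ Finset.range (i + 1), x r * x c * B r c =
      ∑ r ∈ Finset.range (i + 1), ∑ c ∈ Finset.range (i + 1), x r * x c * (B r c - Z r c) := by
    simp_rw [mul_sub, Finset.sum_sub_distrib]
    rw [hzero, sub_zero]
  have hS : (∑ r ∈ Finset.range (i + 1), |x r|) ^ 2 ≤ ((i : ℝ) + 1) * X := by
    simpa using sq_sum_range_le_mul_sum_sq (i + 1) x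
  suffices hmain : ∑ r ∈ Finset.range (i + 1), ∑ c ∈ Finset.range (i + 1),
      x r * x c * (B r c - Z r c) ≤ ((i : ℝ) + 1) * (f + 4 * γ * H) * X by
    have := hB x
    rw [hBsum] at this
    have h2 := mul_lt_mul_of_pos_right hμ hx0
    linarith
  have hterm : ∀ r ≤ i, ∀ c ≤ i, ¬ (r = i ∧ c = i) → x r * x c * (B r c - Z r c) ≤
      |x r| * |x c| * (f + γ * (√(Z r r) * √(Z c c))) := by
    intro r hr c hc hrc
    refine (le_abs_self _).trans ?_
    rw [abs_mul, abs_mul, abs_sub_comm]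
    exact mul_le_mul_of_nonneg_left (hoff r hr c hc hrc) (by positivity)
  rcases le_or_gt (Z i i) (2 * H) with hcase | hcase
  · have hcol' : ∀ r ≤ i, Z r r ≤ 2 * H := fun r hr => by
      rcases hr.lt_or_eq with h | rfl
      · exact hcol r h
      · exact hcase
    have hall : ∀ r ≤ i, ∀ c ≤ i, x r * x c * (B r c - Z r c) ≤
        (f + 2 * γ * H) * (|x r| * |x c|) := by
      intro r hr c hc
      have hprod : √(Z r r) * √(Z c c) ≤ 2 * H := by
        rw [← Real.mul_self_sqrt (show 0 ≤ 2 * H by linarith)]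
        exact mul_le_mul (Real.sqrt_le_sqrt (hcol' r hr)) (Real.sqrt_le_sqrt (hcol' c hc))
          (Real.sqrt_nonneg _) (Real.sqrt_nonneg _)
      by_cases hrc : r = i ∧ c = i
      · obtain ⟨rfl, rfl⟩ := hrc
        rw [abs_mul_abs_self, mul_comm]
        refine mul_le_mul_of_nonneg_right ?_ (mul_self_nonneg _)
        have := mul_le_mul_of_nonneg_left hcase hγ
        have h3 : B c c ≤ f + (1 + γ) * Z c c := hdiag
        linarith
      · refine (hterm r hr c hc hrc).trans ?_
        rw [mul_comm]
        refine mul_le_mul_of_nonneg_right ?_ (by positivity)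
        have := mul_le_mul_of_nonneg_left hprod hγ
        linarith
    calc _ ≤ ∑ r ∈ Finset.range (i + 1), ∑ c ∈ Finset.range (i + 1),
          (f + 2 * γ * H) * (|x r| * |x c|) := by
          refine Finset.sum_le_sum fun r hr => Finset.sum_le_sum fun c hc => hall r ?_ c ?_
          · exact Nat.lt_succ_iff.1 (Finset.mem_range.1 hr)
          · exact Nat.lt_succ_iff.1 (Finset.mem_range.1 hc)
      _ = (f + 2 * γ * H) * (∑ r ∈ Finset.range (i + 1), |x r|) ^ 2 := by
          simp_rw [← Finset.mul_sum]
          rw [← Finset.sum_mul, sq]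
      _ ≤ (f + 2 * γ * H) * (((i : ℝ) + 1) * X) :=
          mul_le_mul_of_nonneg_left hS (by positivity)
      _ ≤ _ := by
          have : 0 ≤ γ * H * (((i : ℝ) + 1) * X) := by positivity
          linarith
  · set y : ℕ → ℝ := fun r => √(Z r r) * |x r| with hy
    have hyi : y i ^ 2 = Z i i * x i ^ 2 := by
      rw [hy]; simp only; rw [mul_pow, Real.sq_sqrt (hZnn i), sq_abs]
    have hall : ∀ r ≤ i, ∀ c ≤ i, x r * x c * (B r c - Z r c) ≤
        f * (|x r| * |x c|) + γ * (y r * y c) -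
          (if r = i then (if c = i then y i ^ 2 / 2 else 0) else 0) := by
      intro r hr c hc
      by_cases hrc : r = i ∧ c = i
      · obtain ⟨rfl, rfl⟩ := hrc
        simp only [if_true]
        have h1 : B c c - Z c c ≤ -(Z c c / 2) := by linarith
        have h2 := mul_le_mul_of_nonneg_left h1 (mul_self_nonneg (x c))
        have h3 : 0 ≤ f * (|x c| * |x c|) := by positivity
        have h4 : 0 ≤ γ * (y c * y c) := mul_nonneg hγ (mul_self_nonneg _)
        rw [hyi]
        linarith
      · have h0 : (if r = i then (if c = i then y i ^ 2 / 2 else 0) else 0) = 0 := by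
          split_ifs with h1 h2
          · exact absurd ⟨h1, h2⟩ hrc
          · rfl
          · rfl
        rw [h0, sub_zero]
        refine (hterm r hr c hc hrc).trans (le_of_eq ?_)
        simp only [hy]; ring
    have hb : (∑ r ∈ Finset.range i, y r) ^ 2 ≤ ((i : ℝ) + 1) * (2 * H * X) := by
      have h1 := sq_sum_range_le_mul_sum_sq i y
      have h2 : ∑ r ∈ Finset.range i, |y r| = ∑ r ∈ Finset.range i, y r :=
        Finset.sum_congr rfl fun r _ => abs_of_nonneg (by positivity)
      rw [h2] at h1
      refine h1.trans ?_
      have h3 : ∑ r ∈ Finset.range i, y r ^ 2 ≤ 2 * H * X := by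
        calc ∑ r ∈ Finset.range i, y r ^ 2 ≤ ∑ r ∈ Finset.range i, 2 * H * x r ^ 2 := by
              refine Finset.sum_le_sum fun r hr => ?_
              rw [hy]; simp only; rw [mul_pow, Real.sq_sqrt (hZnn r), sq_abs]
              exact mul_le_mul_of_nonneg_right (hcol r (Finset.mem_range.1 hr)) (sq_nonneg _)
          _ = 2 * H * ∑ r ∈ Finset.range i, x r ^ 2 := by rw [Finset.mul_sum]
          _ ≤ 2 * H * X := by
              refine mul_le_mul_of_nonneg_left ?_ (by linarith)
              rw [hX, Finset.sum_range_succ]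
              linarith [sq_nonneg (x i)]
      have h4 : 0 ≤ 2 * H * X := by positivity
      have h5 : (0 : ℝ) ≤ i := Nat.cast_nonneg i
      nlinarith
    have hind : ∑ r ∈ Finset.range (i + 1), ∑ c ∈ Finset.range (i + 1),
        (if r = i then (if c = i then y i ^ 2 / 2 else 0) else 0) = y i ^ 2 / 2 := by
      rw [Finset.sum_eq_single_of_mem i (Finset.self_mem_range_succ i) fun b _ hb => by simp [hb]]
      rw [Finset.sum_eq_single_of_mem i (Finset.self_mem_range_succ i) fun b _ hb => by simp [hb]]
      simp
    calc _ ≤ ∑ r ∈ Finset.range (i + 1), ∑ c ∈ Finset.range (i + 1),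
          (f * (|x r| * |x c|) + γ * (y r * y c) -
            (if r = i then (if c = i then y i ^ 2 / 2 else 0) else 0)) := by
          refine Finset.sum_le_sum fun r hr => Finset.sum_le_sum fun c hc => hall r ?_ c ?_
          · exact Nat.lt_succ_iff.1 (Finset.mem_range.1 hr)
          · exact Nat.lt_succ_iff.1 (Finset.mem_range.1 hc)
      _ = f * (∑ r ∈ Finset.range (i + 1), |x r|) ^ 2 +
          γ * (∑ r ∈ Finset.range (i + 1), y r) ^ 2 - y i ^ 2 / 2 := by
          simp_rw [Finset.sum_sub_distrib]
          rw [hind]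
          simp_rw [Finset.sum_add_distrib, ← Finset.mul_sum]
          rw [← Finset.sum_mul, ← Finset.sum_mul]
          ring
      _ ≤ f * (((i : ℝ) + 1) * X) + γ * (2 * (((i : ℝ) + 1) * (2 * H * X))) := by
          have h1 := mul_le_mul_of_nonneg_left hS hf
          have h2 : (∑ r ∈ Finset.range (i + 1), y r) ^ 2 ≤
              2 * (((i : ℝ) + 1) * (2 * H * X)) + 2 * y i ^ 2 := by
            rw [Finset.sum_range_succ]
            nlinarith [sq_nonneg (∑ r ∈ Finset.range i, y r - y i)]
          have h3 := mul_le_mul_of_nonneg_left h2 hγ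
          have h4 : γ * (2 * y i ^ 2) ≤ 1 / 8 * (2 * y i ^ 2) :=
            mul_le_mul_of_nonneg_right hγ' (by positivity)
          nlinarith [sq_nonneg (y i)]
      _ = _ := by ring

section CholeskyRows

variable {δ : FlOp → ℝ} {step : ℕ} {M : ℕ → ℕ → ℝ}

lemma flCholRows_of_le {N r : ℕ} (h : N ≤ r) (c : ℕ) : flCholRows δ step M N r c = 0 := by
  induction N with
  | zero => rfl
  | succ N ih =>
    rw [flCholRows]
    simp only
    rw [if_neg (by omega), ih (by omega)]

lemma flCholRows_eq {N N' r : ℕ} (h : r < N) (h' : N ≤ N') (c : ℕ) :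
    flCholRows δ step M N' r c = flCholRows δ step M N r c := by
  induction N' with
  | zero => omega
  | succ N' ih =>
    rcases h'.lt_or_eq with h'' | rfl
    · rw [flCholRows]
      simp only
      rw [if_neg (by omega), ih (by omega)]
    · rfl

lemma flCholReduced_eq {N N' i : ℕ} (h : i ≤ N) (h' : N ≤ N') (j : ℕ) :
    flCholReduced δ step M (flCholRows δ step M N') i j =
      flCholReduced δ step M (flCholRows δ step M N) i j := by
  refine flSubDot_congr _ _ _ fun k hk => ⟨?_, ?_⟩ <;>
    exact flCholRows_eq (by omega) h' _

lemma flCholRows_lower {n i c : ℕ} (hc : c < i) : flCholRows δ step M n i c = 0 := by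
  rcases le_or_gt n i with h | h
  · exact flCholRows_of_le h c
  · rw [flCholRows_eq (N := i + 1) (by omega) (by omega), flCholRows]
    simp [hc]

lemma flCholRows_diag {n i : ℕ} (hi : i < n) : flCholRows δ step M n i i =
    √(flCholReduced δ step M (flCholRows δ step M n) i i) * (1 + δ (.sqrt step i)) := by
  rw [flCholRows_eq (N := i + 1) (by omega) (by omega), flCholRows]
  simp [flCholReduced_eq (le_refl i) hi.le]

lemma flCholRows_upper {n i c : ℕ} (hi : i < n) (hc : i < c) : flCholRows δ step M n i c =
    flCholReduced δ step M (flCholRows δ step M n) i c / flCholRows δ step M n i i *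
      (1 + δ (.div step i c)) := by
  rw [flCholRows_diag hi, flCholRows_eq (N := i + 1) (by omega) (by omega), flCholRows]
  simp [flCholReduced_eq (le_refl i) hi.le, hc.ne', hc.not_gt]

end CholeskyRows

/-- The rounding errors met in one Cholesky factorization or triangular substitution: every
single one is at most `u`, and the sums of consecutive errors of the additions are at most `τ`. -/
structure SmallPrefixSums (δ : FlOp → ℝ) (u τ : ℝ) (step p n : ℕ) : Prop where
  bound : ∀ o, |δ o| ≤ u
  sum : ∀ i < p, ∀ j < n, ∀ k < n, |∑ l ∈ Finset.range k, δ (.add step i j l)| ≤ τ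

namespace SmallPrefixSums

variable {δ : FlOp → ℝ} {u τ γ ρ : ℝ} {step p n : ℕ}

lemma one_add_pos (h : SmallPrefixSums δ u τ step p n) (hu : u ≤ 1 / 5) (o : FlOp) :
    0 < 1 + δ o := by
  linarith [(abs_le.1 (h.bound o)).1]

lemma nonneg (h : SmallPrefixSums δ u τ step p n) : 0 ≤ u :=
  (abs_nonneg _).trans (h.bound (.sqrt 0 0))

lemma relNear_prod (h : SmallPrefixSums δ u τ step p n) (hu : u ≤ 1 / 5) {i j k : ℕ}
    (hi : i < p) (hj : j < n) (hk : k < n) :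
    RelNear (τ + (n - 1) * (2 * u ^ 2))
      (∏ l ∈ Finset.range k, (1 + δ (.add step i j l)))⁻¹ := by
  refine ((relNear_prod_one_add (Finset.range k) (fun l => h.bound (.add step i j l)) hu
    (h.sum i hi j hj k hk)).inv).mono ?_
  have : (k : ℝ) ≤ n - 1 := by
    have : (k : ℝ) + 1 ≤ n := by exact_mod_cast hk
    linarith
  rw [Finset.card_range]
  have := mul_le_mul_of_nonneg_right this (show 0 ≤ 2 * u ^ 2 by positivity)
  linarith

lemma relNear_mul (h : SmallPrefixSums δ u τ step p n) (hu : u ≤ 1 / 5) {i j k : ℕ}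
    (hi : i < p) (hj : j < n) (hk : k < n) :
    RelNear (τ + (n - 1) * (2 * u ^ 2) + (u + 2 * u ^ 2))
      ((1 + δ (.mul step i j k)) * (∏ l ∈ Finset.range k, (1 + δ (.add step i j l)))⁻¹) := by
  rw [mul_comm (1 + δ _)]
  exact (h.relNear_prod hu hi hj hk).mul (relNear_one_add (h.bound _) hu)

end SmallPrefixSums

section CholeskyError

variable {δ : FlOp → ℝ} {u τ γ ρ : ℝ} {step n : ℕ} {M : ℕ → ℕ → ℝ}

/-- Backward error of an entry of the computed Cholesky factor. -/
lemma abs_sub_sum_flCholRows_le (h : SmallPrefixSums δ u τ step n n) (hu : u ≤ 1 / 5)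
    (hρ : τ + (n - 1) * (2 * u ^ 2) + 2 * (u + 2 * u ^ 2) = ρ) (hρ0 : 0 ≤ ρ) (hρ1 : ρ ≤ 1 / 500)
    {i c : ℕ} (hic : i ≤ c) (hc : c < n)
    (hpos : 0 < flCholReduced δ step M (flCholRows δ step M n) i i) :
    |M i c - ∑ k ∈ Finset.range (i + 1), flCholRows δ step M n k i * flCholRows δ step M n k c| ≤
      1.002 * ρ * ∑ k ∈ Finset.range (i + 1),
        |flCholRows δ step M n k i * flCholRows δ step M n k c| := by
  have hi : i < n := by omega
  have hu0 : 0 ≤ u + 2 * u ^ 2 := by have := h.nonneg; positivity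
  have hfac := h.one_add_pos hu
  have hw : ∀ k < i, |(1 + δ (.mul step i c k)) *
      (∏ l ∈ Finset.range k, (1 + δ (.add step i c l)))⁻¹ - 1| ≤ 1.002 * ρ := fun k hk =>
    ((h.relNear_mul hu hi hc (by omega)).mono (by linarith)).abs_sub_one_le hρ0 hρ1
  rcases hic.lt_or_eq with hlt | rfl
  · refine abs_sub_sum_le_of_flSubDot (d := fun k => δ (.mul step i c k))
      (e := fun k => δ (.add step i c k)) (h := 1 + δ (.div step i c))
      (fun l => hfac _) (hfac _) ?_ hw ?_
    · have hne : flCholRows δ step M n i i ≠ 0 := by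
        rw [flCholRows_diag hi]
        exact mul_ne_zero (Real.sqrt_pos.2 hpos).ne' (hfac _).ne'
      rw [flCholRows_upper hi hlt]
      change _ = flCholReduced δ step M (flCholRows δ step M n) i c * _
      field_simp
    · exact (((h.relNear_prod hu hi hc hi).mul (relNear_one_add (h.bound _) hu).inv).mono
        (by linarith)).abs_sub_one_le hρ0 hρ1
  · refine abs_sub_sum_le_of_flSubDot (d := fun k => δ (.mul step i i k))
      (e := fun k => δ (.add step i i k))
      (h := (1 + δ (.sqrt step i)) * (1 + δ (.sqrt step i)))
      (fun l => hfac _) (mul_pos (hfac _) (hfac _)) ?_ hw ?_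
    · rw [flCholRows_diag hi]
      change _ = flCholReduced δ step M (flCholRows δ step M n) i i * _
      have := Real.mul_self_sqrt hpos.le
      linear_combination (1 + δ (.sqrt step i)) * (1 + δ (.sqrt step i)) * this
    · have h1 := relNear_one_add (h.bound (.sqrt step i)) hu
      exact (((h.relNear_prod hu hi hc hi).mul (h1.mul h1).inv).mono
        (by linarith)).abs_sub_one_le hρ0 hρ1

/-- The rows below the diagonal contribute nothing to the inner product of two columns of the
triangular factor. -/
lemma sum_flCholRows_eq {i N : ℕ} (hN : i < N) (c : ℕ) (g : ℝ → ℝ) (hg : g 0 = 0) :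
    ∑ k ∈ Finset.range N, g (flCholRows δ step M n k i * flCholRows δ step M n k c) =
      ∑ k ∈ Finset.range (i + 1), g (flCholRows δ step M n k i * flCholRows δ step M n k c) := by
  refine (Finset.sum_subset (Finset.range_subset_range.2 (by omega)) fun k _ hk => ?_).symm
  rw [flCholRows_lower (by simpa using hk), zero_mul, hg]

/-- If the entries of `M` are close to those of a symmetric matrix `B` that is bounded below by
`μ` on every leading section, then the Cholesky factorization of `M` completes, and the Gram matrix
of the computed factor is close to `B`. -/
theorem flCholRows_spec (h : SmallPrefixSums δ u τ step n n) (hu : u ≤ 1 / 5)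
    (hρ : τ + (n - 1) * (2 * u ^ 2) + 2 * (u + 2 * u ^ 2) = ρ) (hρ0 : 0 ≤ ρ) (hρ1 : ρ ≤ 1 / 500)
    (hγ : 1.002 * ρ ≤ γ) (hγ1 : γ ≤ 1 / 8)
    {B : ℕ → ℕ → ℝ} {μ f H : ℝ} (hf : 0 ≤ f) (hH : 0 ≤ H) (hsymm : ∀ r c, B r c = B c r)
    (hMB : ∀ r c, r ≤ c → c < n → |M r c - B r c| ≤ f) (hBH : ∀ r < n, B r r + f ≤ H)
    (hB : ∀ N ≤ n, ∀ x : ℕ → ℝ, μ * ∑ r ∈ Finset.range N, x r ^ 2 ≤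
      ∑ r ∈ Finset.range N, ∑ c ∈ Finset.range N, x r * x c * B r c)
    (hμ : (n : ℝ) * (f + 4 * γ * H) < μ) :
    (∀ i < n, 0 < flCholReduced δ step M (flCholRows δ step M n) i i) ∧
    (∀ r < n, (1 - γ) * ∑ k ∈ Finset.range n, flCholRows δ step M n k r *
      flCholRows δ step M n k r ≤ H) ∧
    ∀ r < n, ∀ c < n,
      |∑ k ∈ Finset.range n, flCholRows δ step M n k r * flCholRows δ step M n k c - B r c| ≤
        f + γ * (√(∑ k ∈ Finset.range n, flCholRows δ step M n k r * flCholRows δ step M n k r) *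
          √(∑ k ∈ Finset.range n, flCholRows δ step M n k c * flCholRows δ step M n k c)) := by
  set V := flCholRows δ step M n with hV
  have hγ0 : 0 ≤ γ := by linarith
  -- the Gram matrix of the first `N` rows, in the columns of successful pivots
  have hupper : ∀ N ≤ n, ∀ r c, r ≤ c → c < n → r < N →
      0 < flCholReduced δ step M V r r →
      |M r c - ∑ k ∈ Finset.range N, V k r * V k c| ≤
        γ * (√(∑ k ∈ Finset.range N, V k r * V k r) * √(∑ k ∈ Finset.range N, V k c * V k c)) := by
    intro N hN r c hrc hc hr hpos
    have h1 := abs_sub_sum_flCholRows_le h hu hρ hρ0 hρ1 hrc hc hpos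
    have e1 := sum_flCholRows_eq (δ := δ) (step := step) (M := M) (n := n) hr c id rfl
    have e2 := sum_flCholRows_eq (δ := δ) (step := step) (M := M) (n := n) hr c abs abs_zero
    simp only [id] at e1
    rw [← e1, ← e2] at h1
    refine h1.trans ?_
    have h2 := abs_sum_mul_le_sqrt_mul_sqrt (Finset.range N) (fun k => V k r) (fun k => V k c)
    exact mul_le_mul hγ h2 (Finset.sum_nonneg fun _ _ => abs_nonneg _) hγ0
  have hclose : ∀ N ≤ n, ∀ r c, r ≤ c → c < n → r < N → 0 < flCholReduced δ step M V r r →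
      |∑ k ∈ Finset.range N, V k r * V k c - B r c| ≤ f +
        γ * (√(∑ k ∈ Finset.range N, V k r * V k r) * √(∑ k ∈ Finset.range N, V k c * V k c)) := by
    intro N hN r c hrc hc hr hpos
    have h1 := hupper N hN r c hrc hc hr hpos
    have h2 := hMB r c hrc hc
    rw [abs_sub_comm] at h1
    have h3 := abs_add_le (∑ k ∈ Finset.range N, V k r * V k c - M r c) (M r c - B r c)
    rw [sub_add_sub_cancel] at h3
    linarith
  have hcol : ∀ N ≤ n, ∀ r < N, 0 < flCholReduced δ step M V r r →
      (1 - γ) * ∑ k ∈ Finset.range N, V k r * V k r ≤ H := by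
    intro N hN r hr hpos
    have h1 := hupper N hN r r le_rfl (by omega) hr hpos
    rw [Real.mul_self_sqrt (Finset.sum_nonneg fun k _ => mul_self_nonneg _)] at h1
    have h2 := (abs_le.1 (hMB r r le_rfl (by omega))).2
    have h3 := hBH r (by omega)
    have h4 := (abs_le.1 h1).1
    linarith
  have hpos : ∀ i < n, 0 < flCholReduced δ step M V i i := by
    intro i
    induction i using Nat.strong_induction_on with
    | _ i ih =>
    intro hi
    by_contra hneg
    rw [not_lt] at hneg
    have hM := (abs_le.1 (hMB i i le_rfl hi)).1
    refine false_of_gram_close (i := i) (W := V) (B := B) (μ := μ) (f := f) (γ := γ) (H := H)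
      hf hγ0 hγ1 hH (hB (i + 1) hi) ?_ ?_ ?_ (by linarith [hBH i hi]) ?_
    · intro r hr c hc hrc
      rcases le_total r c with hle | hle
      · have hri : r < i := by
          rcases hr.lt_or_eq with h1 | rfl
          · exact h1
          · exact absurd ⟨rfl, le_antisymm hc hle⟩ hrc
        exact hclose i hi.le r c hle (by omega) hri (ih r hri (by omega))
      · have hci : c < i := by
          rcases hc.lt_or_eq with h1 | rfl
          · exact h1
          · exact absurd ⟨le_antisymm hr hle, rfl⟩ hrc
        have := hclose i hi.le c r hle (by omega) hci (ih c hci (by omega))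
        rw [hsymm c r, mul_comm (√_)] at this
        simpa only [mul_comm] using this
    · have hle := le_mul_sum_of_flSubDot_nonpos (γ := 1.002 * ρ)
        (d := fun k => δ (.mul step i i k)) (e := fun k => δ (.add step i i k))
        (fun l => h.one_add_pos hu _) hneg (fun k hk =>
          ((h.relNear_mul hu hi hi (by omega)).mono (by
            have := h.nonneg
            have : 0 ≤ u + 2 * u ^ 2 := by positivity
            linarith)).abs_sub_one_le hρ0 hρ1)
      have h0 : 0 ≤ ∑ k ∈ Finset.range i, V k i * V k i :=
        Finset.sum_nonneg fun k _ => mul_self_nonneg _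
      have := mul_le_mul_of_nonneg_right hγ h0
      linarith
    · intro r hr
      have h1 := hcol i hi.le r hr (ih r hr (by omega))
      have h0 : 0 ≤ ∑ k ∈ Finset.range i, V k r * V k r :=
        Finset.sum_nonneg fun k _ => mul_self_nonneg _
      nlinarith
    · refine lt_of_le_of_lt ?_ hμ
      refine mul_le_mul_of_nonneg_right ?_ (by positivity)
      exact_mod_cast hi
  refine ⟨hpos, fun r hr => hcol n le_rfl r hr (hpos r hr), fun r hr c hc => ?_⟩
  rcases le_total r c with hle | hle
  · exact hclose n le_rfl r c hle hc hr (hpos r hr)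
  · have := hclose n le_rfl c r hle hr hc (hpos c hc)
    rw [hsymm c r, mul_comm (√_)] at this
    simpa only [mul_comm] using this

end CholeskyError

/-! ### Error bounds in matrix form -/

/-- The rounding errors met in one computed Gram matrix of order `n` with inner products of
length `N`: every single one is at most `u`, and the sums of the last errors of the additions are
at most `τ`. -/
structure SmallSuffixSums (δ : FlOp → ℝ) (u τ : ℝ) (step n N : ℕ) : Prop where
  bound : ∀ o, |δ o| ≤ u
  sum : ∀ i < n, ∀ j < n, ∀ a, 1 ≤ a → |∑ l ∈ Finset.Ico a N, δ (.add step i j l)| ≤ τ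

section MatrixForm

variable {δ : FlOp → ℝ} {u τ γ ρ : ℝ} {step m n : ℕ}

@[simp]
lemma toArr_coe (A : Matrix (Fin m) (Fin n) ℝ) (i : Fin m) (j : Fin n) :
    toArr A i j = A i j := by
  simp [toArr]

lemma sum_range_toArr (g : ℕ → ℝ) (g' : Fin n → ℝ) (h : ∀ k : Fin n, g k = g' k) :
    ∑ k ∈ Finset.range n, g k = ∑ k, g' k := by
  rw [← Fin.sum_univ_eq_sum_range]
  exact Finset.sum_congr rfl fun k _ => h k

/-- Forward error of a computed Gram matrix. -/
lemma abs_flMatMul_transpose_sub_le (h : SmallSuffixSums δ u τ step n m) (hu : u ≤ 1 / 5)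
    (hρ : τ + (m - 1) * (2 * u ^ 2) + (u + 2 * u ^ 2) = ρ) (hρ0 : 0 ≤ ρ) (hρ1 : ρ ≤ 1 / 500)
    (hγ : 1.002 * ρ ≤ γ) (A : Matrix (Fin m) (Fin n) ℝ) (i j : Fin n) :
    |flMatMul δ step A.transpose A i j - ∑ k, A k i * A k j| ≤
      γ * (√(∑ k, A k i ^ 2) * √(∑ k, A k j ^ 2)) := by
  have hw : ∀ k < m, |(1 + δ (.mul step i j k)) *
      ∏ l ∈ Finset.Ico (max k 1) m, (1 + δ (.add step i j l)) - 1| ≤ γ := by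
    intro k hk
    refine (((relNear_one_add (h.bound _) hu).mul (relNear_prod_one_add (Finset.Ico (max k 1) m)
      (fun l => h.bound (.add step i j l)) hu (h.sum i i.2 j j.2 _ (le_max_right _ _)))).mono
        ?_).abs_sub_one_le hρ0 hρ1 |>.trans hγ
    have h1 : ((Finset.Ico (max k 1) m).card : ℝ) ≤ m - 1 := by
      rw [Nat.card_Ico]
      have : m - max k 1 + 1 ≤ m := by omega
      have : ((m - max k 1 : ℕ) : ℝ) + 1 ≤ m := by exact_mod_cast this
      linarith
    have := mul_le_mul_of_nonneg_right h1 (show 0 ≤ 2 * u ^ 2 by positivity)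
    linarith
  have h1 := abs_flDot_sub_le (d := fun k => δ (.mul step i j k))
    (e := fun k => δ (.add step i j k)) (x := fun k => toArr A.transpose i k)
    (y := fun k => toArr A k j) hw
  have h2 := abs_sum_mul_le_sqrt_mul_sqrt (Finset.range m) (fun k => toArr A.transpose i k)
    (fun k => toArr A k j)
  have e1 := sum_range_toArr (fun k => toArr A.transpose i k * toArr A k j)
    (fun k => A k i * A k j) (fun k => by simp)
  have e2 := sum_range_toArr (fun k => toArr A.transpose i k * toArr A.transpose i k)
    (fun k => A k i ^ 2) (fun k => by simp [sq])
  have e3 := sum_range_toArr (fun k => toArr A k j * toArr A k j)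
    (fun k => A k j ^ 2) (fun k => by simp [sq])
  have hγ0 : 0 ≤ γ := by linarith
  rw [e2, e3] at h2
  rw [e1] at h1
  exact h1.trans (mul_le_mul_of_nonneg_left h2 hγ0)

lemma flSolveRow_eq {T V : ℕ → ℕ → ℝ} {r N N' c : ℕ} (h : c < N) (h' : N ≤ N') :
    flSolveRow δ step T V r N' c = flSolveRow δ step T V r N c := by
  induction N' with
  | zero => omega
  | succ N' ih =>
    rcases h'.lt_or_eq with h'' | rfl
    · rw [flSolveRow]
      simp only
      rw [if_neg (by omega), ih (by omega)]
    · rfl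

lemma flSolveRow_apply {T V : ℕ → ℕ → ℝ} {r n j : ℕ} (hj : j < n) :
    flSolveRow δ step T V r n j =
      flSubDot (fun k => δ (.mul step r j k)) (fun k => δ (.add step r j k)) (T r j)
        (flSolveRow δ step T V r n) (fun k => V k j) j / V j j * (1 + δ (.div step r j)) := by
  rw [flSolveRow_eq (N := j + 1) (by omega) (by omega), flSolveRow]
  simp only [if_true]
  rw [flSubDot_congr _ _ _ (x' := flSolveRow δ step T V r n) (y' := fun k => V k j)
    fun k hk => ⟨(flSolveRow_eq hk hj.le).symm, rfl⟩]

/-- Residual of a computed triangular substitution. -/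
lemma abs_sub_flSolve_mul_le (h : SmallPrefixSums δ u τ step m n) (hu : u ≤ 1 / 5)
    (hρ : τ + (n - 1) * (2 * u ^ 2) + (u + 2 * u ^ 2) = ρ) (hρ0 : 0 ≤ ρ) (hρ1 : ρ ≤ 1 / 500)
    (hγ : 1.002 * ρ ≤ γ) (A : Matrix (Fin m) (Fin n) ℝ) {V : Matrix (Fin n) (Fin n) ℝ}
    (hdiag : ∀ j, V j j ≠ 0) (htri : ∀ i j, j < i → V i j = 0) (r : Fin m) (j : Fin n) :
    |A r j - ∑ k, flSolve δ step A V r k * V k j| ≤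
      γ * (√(∑ k, flSolve δ step A V r k ^ 2) * √(∑ k, V k j ^ 2)) := by
  have hfac := h.one_add_pos hu
  set q := flSolveRow δ step (toArr A) (toArr V) r n with hq
  have h1 := abs_sub_sum_le_of_flSubDot (d := fun k => δ (.mul step r j k))
    (e := fun k => δ (.add step r j k)) (x := q) (y := fun k => toArr V k j) (a := toArr A r j)
    (h := 1 + δ (.div step r j)) (N := j) (γ := γ) (fun l => hfac _) (hfac _) (by
      have := hdiag j
      rw [hq, flSolveRow_apply j.2, toArr_coe, toArr_coe]
      field_simp) (fun k hk =>
        ((h.relNear_mul hu r.2 j.2 (hk.trans j.2)).mono hρ.le).abs_sub_one_le hρ0 hρ1 |>.trans hγ)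
      ((((h.relNear_prod hu r.2 j.2 j.2).mul (relNear_one_add (h.bound _) hu).inv).mono
        hρ.le).abs_sub_one_le hρ0 hρ1 |>.trans hγ)
  have hfull : ∀ g : ℝ → ℝ, g 0 = 0 → ∑ k ∈ Finset.range (j + 1), g (q k * toArr V k j) =
      ∑ k ∈ Finset.range n, g (q k * toArr V k j) := by
    intro g hg
    refine Finset.sum_subset (Finset.range_subset_range.2 (by omega)) fun k hk hk' => ?_
    have hkn := Finset.mem_range.1 hk
    have : toArr V k j = 0 := by
      rw [show k = ((⟨k, hkn⟩ : Fin n) : ℕ) from rfl, toArr_coe]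
      exact htri _ _ (by rw [Fin.lt_def]; simpa using hk')
    rw [this, mul_zero, hg]
  have e0 := hfull id rfl
  simp only [id] at e0
  have h2 := abs_sum_mul_le_sqrt_mul_sqrt (Finset.range n) q (fun k => toArr V k j)
  rw [e0, hfull abs abs_zero] at h1
  have e1 := sum_range_toArr (fun k => q k * toArr V k j)
    (fun k => flSolve δ step A V r k * V k j) (fun k => by simp [flSolve, hq])
  have e2 := sum_range_toArr (fun k => q k * q k)
    (fun k => flSolve δ step A V r k ^ 2) (fun k => by simp [flSolve, hq, sq])
  have e3 := sum_range_toArr (fun k => toArr V k j * toArr V k j)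
    (fun k => V k j ^ 2) (fun k => by simp [sq])
  rw [e1, toArr_coe] at h1
  rw [e2, e3] at h2
  exact h1.trans (mul_le_mul_of_nonneg_left h2 (by linarith))

lemma flCholesky_lower (U : Matrix (Fin n) (Fin n) ℝ) {i j : Fin n} (h : j < i) :
    flCholesky δ step U i j = 0 :=
  flCholRows_lower h

lemma flCholesky_diag_ne_zero (h : SmallPrefixSums δ u τ step n n) (hu : u ≤ 1 / 5)
    {U : Matrix (Fin n) (Fin n) ℝ} (hc : FlCholeskyCompletes δ step U) (j : Fin n) :
    flCholesky δ step U j j ≠ 0 := by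
  have := hc j j.2
  rw [← flCholReduced_eq le_rfl j.2.le] at this
  change flCholRows δ step (toArr U) n j j ≠ 0
  rw [flCholRows_diag j.2]
  exact mul_ne_zero (Real.sqrt_pos.2 this).ne' (h.one_add_pos hu _).ne'

lemma sum_sum_mul_le_of_entry_le {E : Matrix (Fin n) (Fin n) ℝ} {ε : ℝ} (hε : 0 ≤ ε)
    (hE : ∀ r c, |E r c| ≤ ε) (x : Fin n → ℝ) :
    |∑ r, ∑ c, x r * x c * E r c| ≤ n * ε * ∑ r, x r ^ 2 := by
  calc |∑ r, ∑ c, x r * x c * E r c| ≤ ∑ r, ∑ c, |x r| * |x c| * ε := by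
        refine (Finset.abs_sum_le_sum_abs _ _).trans (Finset.sum_le_sum fun r _ => ?_)
        refine (Finset.abs_sum_le_sum_abs _ _).trans (Finset.sum_le_sum fun c _ => ?_)
        rw [abs_mul, abs_mul]
        exact mul_le_mul_of_nonneg_left (hE r c) (by positivity)
    _ = ε * (∑ r, |x r|) ^ 2 := by
        simp_rw [← Finset.sum_mul]
        rw [sq, Finset.sum_mul_sum, mul_comm]
    _ ≤ ε * (n * ∑ r, x r ^ 2) := by
        refine mul_le_mul_of_nonneg_left ?_ hε
        simpa using sq_sum_le_card_mul_sum_sq (s := Finset.univ) (f := fun r => |x r|)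
    _ = _ := by ring

lemma norm_sq_toEuclideanLin (A : Matrix (Fin m) (Fin n) ℝ) (x : EuclideanSpace ℝ (Fin n)) :
    ‖Matrix.toEuclideanLin A x‖ ^ 2 = ∑ i, (∑ j, A i j * x j) ^ 2 := by
  rw [EuclideanSpace.real_norm_sq_eq]
  rfl

lemma norm_sq_toEuclideanLin_eq_sum_sum (A : Matrix (Fin m) (Fin n) ℝ)
    (x : EuclideanSpace ℝ (Fin n)) :
    ‖Matrix.toEuclideanLin A x‖ ^ 2 = ∑ r, ∑ c, x r * x c * ∑ k, A k r * A k c := by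
  rw [norm_sq_toEuclideanLin]
  simp_rw [sq, Finset.sum_mul_sum, Finset.mul_sum]
  rw [Finset.sum_comm]
  refine Finset.sum_congr rfl fun r _ => ?_
  rw [Finset.sum_comm]
  exact Finset.sum_congr rfl fun c _ => Finset.sum_congr rfl fun k _ => by ring

lemma norm_toEuclideanLin_le_sqrt (E : Matrix (Fin m) (Fin n) ℝ) (x : EuclideanSpace ℝ (Fin n)) :
    ‖Matrix.toEuclideanLin E x‖ ≤ √(∑ i, ∑ j, E i j ^ 2) * ‖x‖ := by
  refine abs_le_of_sq_le_sq' ?_ (by positivity) |>.2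
  rw [norm_sq_toEuclideanLin, mul_pow, Real.sq_sqrt (by positivity), EuclideanSpace.real_norm_sq_eq,
    Finset.sum_mul]
  exact Finset.sum_le_sum fun i _ => Finset.sum_mul_sq_le_sq_mul_sq _ _ _

/-- Cholesky factorization of a computed matrix `U` close to `Aᵀ A + s I`. -/
theorem flCholesky_spec (h : SmallPrefixSums δ u τ step n n) (hu : u ≤ 1 / 5)
    (hρ : τ + (n - 1) * (2 * u ^ 2) + 2 * (u + 2 * u ^ 2) = ρ) (hρ0 : 0 ≤ ρ) (hρ1 : ρ ≤ 1 / 500)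
    (hγ : 1.002 * ρ ≤ γ) (hγ1 : γ ≤ 9 / 10000)
    {A : Matrix (Fin m) (Fin n) ℝ} {U : Matrix (Fin n) (Fin n) ℝ} {s μ f H : ℝ}
    (hf : 0 ≤ f) (hH : 0 ≤ H)
    (hU : ∀ i j, i ≤ j → |U i j - (∑ k, A k i * A k j + if i = j then s else 0)| ≤ f)
    (hAH : ∀ j, ∑ k, A k j ^ 2 + s + f ≤ H)
    (hlow : ∀ x : EuclideanSpace ℝ (Fin n),
      μ * ‖x‖ ^ 2 ≤ ‖Matrix.toEuclideanLin A x‖ ^ 2 + s * ‖x‖ ^ 2)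
    (hμ : (n : ℝ) * (f + 4 * γ * H) < μ) :
    FlCholeskyCompletes δ step U ∧
    (∀ j, ∑ k, flCholesky δ step U k j ^ 2 ≤ 1.001 * H) ∧
    ∀ x : EuclideanSpace ℝ (Fin n), |‖Matrix.toEuclideanLin (flCholesky δ step U) x‖ ^ 2 -
      (‖Matrix.toEuclideanLin A x‖ ^ 2 + s * ‖x‖ ^ 2)| ≤
        n * (f + γ * (1.001 * H)) * ‖x‖ ^ 2 := by
  set B : Matrix (Fin n) (Fin n) ℝ :=
    Matrix.of fun i j => ∑ k, A k i * A k j + if i = j then s else 0 with hBdef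
  have hquad : ∀ x : Fin n → ℝ, ∑ r, ∑ c, x r * x c * B r c =
      ‖Matrix.toEuclideanLin A (WithLp.toLp 2 x)‖ ^ 2 + s * ‖WithLp.toLp 2 x‖ ^ 2 := by
    intro x
    rw [norm_sq_toEuclideanLin_eq_sum_sum, EuclideanSpace.real_norm_sq_eq, Finset.mul_sum,
      ← Finset.sum_add_distrib]
    refine Finset.sum_congr rfl fun r _ => ?_
    simp only [hBdef, Matrix.of_apply, mul_add, Finset.sum_add_distrib, mul_ite, mul_zero,
      Finset.sum_ite_eq, Finset.mem_univ, if_true]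
    ring
  have hγ0 : 0 ≤ γ := by linarith
  have hspec := flCholRows_spec (M := toArr U) (B := toArr B) (μ := μ) (f := f) (H := H)
    h hu hρ hρ0 hρ1 hγ (by linarith) hf hH ?_ ?_ ?_ ?_ hμ
  · obtain ⟨h1, h2, h3⟩ := hspec
    have e : ∀ r c : Fin n, ∑ k ∈ Finset.range n, flCholRows δ step (toArr U) n k r *
        flCholRows δ step (toArr U) n k c =
          ∑ k, flCholesky δ step U k r * flCholesky δ step U k c := fun r c =>
      sum_range_toArr _ _ fun k => rfl
    have hcol : ∀ j, ∑ k, flCholesky δ step U k j ^ 2 ≤ 1.001 * H := by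
      intro j
      have h4 := h2 j j.2
      rw [e] at h4
      simp_rw [← sq] at h4
      have h0 : 0 ≤ ∑ k, flCholesky δ step U k j ^ 2 := by positivity
      nlinarith
    refine ⟨fun i hi => ?_, hcol, fun x => ?_⟩
    · rw [← flCholReduced_eq le_rfl hi.le]
      exact h1 i hi
    · rw [norm_sq_toEuclideanLin_eq_sum_sum (flCholesky δ step U)]
      have hx := hquad x
      rw [show WithLp.toLp 2 (fun i => x i) = x from rfl] at hx
      rw [← hx, ← Finset.sum_sub_distrib, EuclideanSpace.real_norm_sq_eq]
      simp_rw [← Finset.sum_sub_distrib, ← mul_sub]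
      refine sum_sum_mul_le_of_entry_le
        (E := Matrix.of fun r c =>
          ∑ k, flCholesky δ step U k r * flCholesky δ step U k c - B r c)
        (by positivity) (fun r c => ?_) _
      have h4 := h3 r r.2 c c.2
      rw [e, e, e, toArr_coe] at h4
      refine h4.trans ?_
      have h5 : √(∑ k, flCholesky δ step U k r * flCholesky δ step U k r) *
          √(∑ k, flCholesky δ step U k c * flCholesky δ step U k c) ≤ 1.001 * H := by
        rw [← Real.mul_self_sqrt (show 0 ≤ 1.001 * H by positivity)]
        simp_rw [← sq (flCholesky δ step U _ _)]
        exact mul_le_mul (Real.sqrt_le_sqrt (hcol r)) (Real.sqrt_le_sqrt (hcol c))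
          (Real.sqrt_nonneg _) (Real.sqrt_nonneg _)
      have := mul_le_mul_of_nonneg_left h5 hγ0
      linarith
  · intro r c
    simp only [toArr, hBdef, Matrix.of_apply, and_comm (a := r < n), Fin.mk.injEq, eq_comm (a := r)]
    simp_rw [mul_comm (A _ ⟨r, _⟩)]
  · intro r c hrc hc
    have := hU ⟨r, by omega⟩ ⟨c, hc⟩ hrc
    simp only [toArr, hBdef, Matrix.of_apply]
    rw [dif_pos ⟨by omega, hc⟩, dif_pos ⟨by omega, hc⟩]
    exact this
  · intro r hr
    have := hAH ⟨r, hr⟩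
    simp only [toArr, hBdef, Matrix.of_apply]
    rw [dif_pos ⟨hr, hr⟩]
    simpa [sq] using this
  · intro N hN x
    set y : ℕ → ℝ := fun r => if r < N then x r else 0 with hy
    have e1 : ∑ r ∈ Finset.range N, x r ^ 2 = ∑ r : Fin n, y r ^ 2 := by
      rw [Fin.sum_univ_eq_sum_range (fun r => y r ^ 2),
        ← Finset.sum_subset (Finset.range_subset_range.2 hN) fun r _ hr => ?_]
      · exact Finset.sum_congr rfl fun r hr => by simp [hy, Finset.mem_range.1 hr]
      · have : ¬ r < N := by simpa using hr
        simp [hy, this]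
    have e2 : ∑ r ∈ Finset.range N, ∑ c ∈ Finset.range N, x r * x c * toArr B r c =
        ∑ r : Fin n, ∑ c : Fin n, y r * y c * B r c := by
      have e3 : ∀ r, ∑ c ∈ Finset.range N, x r * x c * toArr B r c =
          ∑ c ∈ Finset.range n, x r * y c * toArr B r c := by
        intro r
        rw [← Finset.sum_subset (Finset.range_subset_range.2 hN) fun c _ hc => ?_]
        · exact Finset.sum_congr rfl fun c hc => by simp [hy, Finset.mem_range.1 hc]
        · have : ¬ c < N := by simpa using hc
          simp [hy, this]
      simp_rw [e3]
      rw [← sum_range_toArr (fun r => ∑ c ∈ Finset.range n, y r * y c * toArr B r c) _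
        (fun r => sum_range_toArr _ _ fun c => by rw [toArr_coe])]
      rw [← Finset.sum_subset (Finset.range_subset_range.2 hN) fun r _ hr => ?_]
      · exact Finset.sum_congr rfl fun r hr => by simp [hy, Finset.mem_range.1 hr]
      · have : ¬ r < N := by simpa using hr
        simp [hy, this]
    rw [e1, e2, hquad fun r => y r]
    have := hlow (WithLp.toLp 2 fun r : Fin n => y r)
    rwa [EuclideanSpace.real_norm_sq_eq (WithLp.toLp 2 fun r : Fin n => y r)] at this ⊢

/-- Residual of the triangular substitution as an operator bound. -/
theorem norm_sub_flSolve_le (h : SmallPrefixSums δ u τ step m n) (hu : u ≤ 1 / 5)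
    (hρ : τ + (n - 1) * (2 * u ^ 2) + (u + 2 * u ^ 2) = ρ) (hρ0 : 0 ≤ ρ) (hρ1 : ρ ≤ 1 / 500)
    (hγ : 1.002 * ρ ≤ γ) (A : Matrix (Fin m) (Fin n) ℝ) {V : Matrix (Fin n) (Fin n) ℝ}
    (hdiag : ∀ j, V j j ≠ 0) (htri : ∀ i j, j < i → V i j = 0) {v q : ℝ} (hv0 : 0 ≤ v)
    (hq0 : 0 ≤ q) (hv : ∀ j, ∑ k, V k j ^ 2 ≤ v ^ 2)
    (hq : ∀ j, ∑ k, flSolve δ step A V k j ^ 2 ≤ q ^ 2) (x : EuclideanSpace ℝ (Fin n)) :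
    ‖Matrix.toEuclideanLin A x - Matrix.toEuclideanLin (flSolve δ step A V)
      (Matrix.toEuclideanLin V x)‖ ≤ n * γ * q * v * ‖x‖ := by
  set Q := flSolve δ step A V with hQ
  have hγ0 : 0 ≤ γ := by linarith
  have e : Matrix.toEuclideanLin A x - Matrix.toEuclideanLin Q (Matrix.toEuclideanLin V x) =
      Matrix.toEuclideanLin (A - Q * V) x := by
    simp [Matrix.toLpLin_apply, Matrix.mulVec_mulVec]
  rw [e]
  refine (norm_toEuclideanLin_le_sqrt _ _).trans (mul_le_mul_of_nonneg_right ?_ (norm_nonneg _))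
  refine Real.sqrt_le_iff.2 ⟨by positivity, ?_⟩
  calc ∑ i, ∑ j, (A - Q * V) i j ^ 2
      ≤ ∑ i, ∑ j, γ ^ 2 * ((∑ k, Q i k ^ 2) * ∑ k, V k j ^ 2) := by
        refine Finset.sum_le_sum fun i _ => Finset.sum_le_sum fun j _ => ?_
        have h1 := abs_sub_flSolve_mul_le h hu hρ hρ0 hρ1 hγ A hdiag htri i j
        rw [← sq_abs, Matrix.sub_apply, Matrix.mul_apply]
        refine (pow_le_pow_left₀ (abs_nonneg _) h1 2).trans (le_of_eq ?_)
        rw [mul_pow, mul_pow, Real.sq_sqrt (by positivity), Real.sq_sqrt (by positivity)]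
    _ = γ ^ 2 * ((∑ k, ∑ i, Q i k ^ 2) * ∑ j, ∑ k, V k j ^ 2) := by
        rw [Finset.sum_comm (f := fun k i => Q i k ^ 2), Finset.sum_mul_sum]
        simp_rw [Finset.mul_sum]
    _ ≤ γ ^ 2 * ((n * q ^ 2) * (n * v ^ 2)) := by
        refine mul_le_mul_of_nonneg_left ?_ (by positivity)
        refine mul_le_mul ?_ ?_ (by positivity) (by positivity)
        · refine (Finset.sum_le_sum fun k _ => hq k).trans ?_
          simp
        · refine (Finset.sum_le_sum fun k _ => hv k).trans ?_
          simp
    _ = _ := by ring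

end MatrixForm

/-! ### Norms, singular values and the error bounds of one sweep -/

section NormLemmas

variable {m n : ℕ}

lemma norm2_nonneg (A : Matrix (Fin m) (Fin n) ℝ) : 0 ≤ norm2 A := norm_nonneg _

lemma norm_toEuclideanLin_le_norm2 (A : Matrix (Fin m) (Fin n) ℝ)
    (x : EuclideanSpace ℝ (Fin n)) : ‖Matrix.toEuclideanLin A x‖ ≤ norm2 A * ‖x‖ :=
  (Matrix.toEuclideanLin A).toContinuousLinearMap.le_opNorm x

lemma norm2_le {A : Matrix (Fin m) (Fin n) ℝ} {c : ℝ} (hc : 0 ≤ c)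
    (h : ∀ x, ‖Matrix.toEuclideanLin A x‖ ≤ c * ‖x‖) : norm2 A ≤ c :=
  ContinuousLinearMap.opNorm_le_bound _ hc h

lemma sigmaMin_nonneg (A : Matrix (Fin m) (Fin n) ℝ) : 0 ≤ sigmaMin A :=
  LinearMap.singularValues_nonneg _ _

/-- The square norm of `A x` in terms of the coordinates of `x` in right singular vectors. -/
lemma norm_sq_eq_sum_singularValues (A : Matrix (Fin m) (Fin n) ℝ) (x : EuclideanSpace ℝ (Fin n)) :
    ‖Matrix.toEuclideanLin A x‖ ^ 2 = ∑ i : Fin n,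
      (Matrix.toEuclideanLin A).singularValues i ^ 2 *
        ((Matrix.toEuclideanLin A).isSymmetric_adjoint_comp_self.eigenvectorBasis
          (finrank_euclideanSpace_fin (𝕜 := ℝ)) |>.repr x i) ^ 2 := by
  set L := Matrix.toEuclideanLin A
  have hn : Module.finrank ℝ (EuclideanSpace ℝ (Fin n)) = n := finrank_euclideanSpace_fin
  set b := L.isSymmetric_adjoint_comp_self.eigenvectorBasis hn with hb
  have h1 : ‖L x‖ ^ 2 = inner ℝ x ((LinearMap.adjoint L ∘ₗ L) x) := by
    rw [LinearMap.comp_apply, LinearMap.adjoint_inner_right, real_inner_self_eq_norm_sq]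
  rw [h1, ← b.sum_inner_mul_inner x]
  refine Finset.sum_congr rfl fun i _ => ?_
  rw [← b.repr_apply_apply ((LinearMap.adjoint L ∘ₗ L) x), hb,
    L.isSymmetric_adjoint_comp_self.eigenvectorBasis_apply_self_apply hn x i,
    L.sq_singularValues_fin hn, ← hb, b.repr_apply_apply, real_inner_comm]
  simp only [RCLike.ofReal_real_eq_id, id]
  ring

lemma sigmaMin_mul_norm_le (A : Matrix (Fin m) (Fin n) ℝ) (x : EuclideanSpace ℝ (Fin n)) :
    sigmaMin A * ‖x‖ ≤ ‖Matrix.toEuclideanLin A x‖ := by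
  refine abs_le_of_sq_le_sq' ?_ (norm_nonneg _) |>.2
  rw [norm_sq_eq_sum_singularValues, mul_pow]
  set b := (Matrix.toEuclideanLin A).isSymmetric_adjoint_comp_self.eigenvectorBasis
          (finrank_euclideanSpace_fin (𝕜 := ℝ) (n := n))
  rw [← b.repr.norm_map x, EuclideanSpace.real_norm_sq_eq, Finset.mul_sum]
  refine Finset.sum_le_sum fun i _ => mul_le_mul_of_nonneg_right ?_ (sq_nonneg _)
  refine pow_le_pow_left₀ (sigmaMin_nonneg A) ?_ 2
  exact LinearMap.singularValues_antitone _ (by omega)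

lemma le_sigmaMin (hn : 1 ≤ n) {A : Matrix (Fin m) (Fin n) ℝ} {c : ℝ}
    (h : ∀ x, c * ‖x‖ ≤ ‖Matrix.toEuclideanLin A x‖) : c ≤ sigmaMin A := by
  set b := (Matrix.toEuclideanLin A).isSymmetric_adjoint_comp_self.eigenvectorBasis
          (finrank_euclideanSpace_fin (𝕜 := ℝ) (n := n)) with hb
  set i : Fin n := ⟨n - 1, by omega⟩
  have h1 := h (b i)
  have h2 := norm_sq_eq_sum_singularValues A (b i)
  rw [← hb] at h2
  rw [b.norm_eq_one i, mul_one] at h1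
  refine h1.trans (abs_le_of_sq_le_sq' ?_ (sigmaMin_nonneg A)).2
  rw [h2, Finset.sum_eq_single i]
  · simp [sigmaMin, i]
  · intro j _ hj
    simp [hj]
  · simp

lemma rank_eq_iff_sigmaMin_pos (hn : 1 ≤ n) (A : Matrix (Fin m) (Fin n) ℝ) :
    A.rank = n ↔ 0 < sigmaMin A := by
  have h1 : A.rank = Module.finrank ℝ (LinearMap.range (Matrix.toEuclideanLin A)) := by
    exact Matrix.rank_eq_finrank_range_toLin A (PiLp.basisFun 2 ℝ (Fin m))
      (PiLp.basisFun 2 ℝ (Fin n))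
  rw [sigmaMin, LinearMap.singularValues_pos_iff_lt_finrank_range, ← h1]
  have := A.rank_le_width
  omega

lemma norm_sq_toEuclideanLin_single (A : Matrix (Fin m) (Fin n) ℝ) (j : Fin n) :
    ‖Matrix.toEuclideanLin A (EuclideanSpace.single j 1)‖ ^ 2 = ∑ i, A i j ^ 2 := by
  rw [norm_sq_toEuclideanLin]
  simp

lemma gNorm_nonneg (A : Matrix (Fin m) (Fin n) ℝ) : 0 ≤ gNorm A :=
  Real.iSup_nonneg fun _ => Real.sqrt_nonneg _

lemma sqrt_sum_sq_le_gNorm (A : Matrix (Fin m) (Fin n) ℝ) (j : Fin n) :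
    √(∑ i, A i j ^ 2) ≤ gNorm A :=
  le_ciSup (f := fun j => √(∑ i : Fin m, A i j ^ 2)) (Finite.bddAbove_range _) j

lemma sum_sq_le_gNorm_sq (A : Matrix (Fin m) (Fin n) ℝ) (j : Fin n) :
    ∑ i, A i j ^ 2 ≤ gNorm A ^ 2 :=
  (Real.sqrt_le_left (gNorm_nonneg A)).1 (sqrt_sum_sq_le_gNorm A j)

lemma gNorm_le_norm2 (A : Matrix (Fin m) (Fin n) ℝ) : gNorm A ≤ norm2 A := by
  refine Real.iSup_le (fun j => Real.sqrt_le_iff.2 ⟨norm2_nonneg A, ?_⟩) (norm2_nonneg A)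
  rw [← norm_sq_toEuclideanLin_single]
  have := norm_toEuclideanLin_le_norm2 A (EuclideanSpace.single j 1)
  rw [PiLp.norm_single, norm_one, mul_one] at this
  exact pow_le_pow_left₀ (norm_nonneg _) this 2

lemma sigmaMin_le_gNorm (hn : 1 ≤ n) (A : Matrix (Fin m) (Fin n) ℝ) : sigmaMin A ≤ gNorm A := by
  have h := sigmaMin_mul_norm_le A (EuclideanSpace.single ⟨0, hn⟩ 1)
  rw [PiLp.norm_single, norm_one, mul_one] at h
  refine h.trans (le_trans (le_of_eq ?_) (sqrt_sum_sq_le_gNorm A ⟨0, hn⟩))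
  rw [← norm_sq_toEuclideanLin_single, Real.sqrt_sq (norm_nonneg _)]

lemma pRatio_nonneg (A : Matrix (Fin m) (Fin n) ℝ) : 0 ≤ pRatio A :=
  div_nonneg (gNorm_nonneg A) (norm2_nonneg A)

lemma pRatio_le_one (A : Matrix (Fin m) (Fin n) ℝ) : pRatio A ≤ 1 :=
  div_le_one_of_le₀ (gNorm_le_norm2 A) (norm2_nonneg A)

/-- For `A = 0` the ratio has the junk value `0`, which is harmless here because `‖A‖_g = 0`. -/
lemma pRatio_mul_norm2 (A : Matrix (Fin m) (Fin n) ℝ) : pRatio A * norm2 A = gNorm A := by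
  rcases eq_or_ne (norm2 A) 0 with h | h
  · rw [h, mul_zero]
    exact le_antisymm (gNorm_nonneg A) (h ▸ gNorm_le_norm2 A)
  · exact div_mul_cancel₀ _ h

lemma kappa2_nonneg (A : Matrix (Fin m) (Fin n) ℝ) : 0 ≤ kappa2 A :=
  div_nonneg (norm2_nonneg A) (sigmaMin_nonneg A)

end NormLemmas

/-- The conditions on the sizes, the unit roundoff and `λ` under which the rounding errors are
controlled. The lower bound of `λ²` is what positivity of the probability bound gives. -/
structure RoundingSetting (m n : ℕ) (u lam : ℝ) : Prop where
  one_le : 1 ≤ n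
  le : n ≤ m
  u_pos : 0 < u
  lam_pos : 0 < lam
  lam_sq : 1.386 ≤ lam ^ 2
  size_m : lam * √m * n * u ≤ 1 / 2200
  size_mn : m * n * u ≤ 1 / 2200
  size_n : lam * √(n + 1) * n * u ≤ 1 / 2200
  size_nn : n * (n + 1) * u ≤ 1 / 2200

/-- The Cauchy-Schwarz inequality for `(√2 λ, b / √k)` and `(√p, √k)`: it absorbs the errors `b`
that are not summed probabilistically into the constant `C`. -/
lemma sqrt_two_mul_add_le {lam p k b C : ℝ} (hlam : 0 ≤ lam) (hp : 0 ≤ p) (hk : 0 < k)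
    (hC : 0 ≤ C) (h : 2 * lam ^ 2 * k + b ^ 2 ≤ C ^ 2 * lam ^ 2 * k) :
    √2 * lam * √p + b ≤ C * lam * √(p + k) := by
  refine abs_le_of_sq_le_sq' ?_ (by positivity) |>.2
  have h2 : √2 ^ 2 = 2 := Real.sq_sqrt (by norm_num)
  have hp2 : √p ^ 2 = p := Real.sq_sqrt hp
  rw [mul_pow (C * lam), Real.sq_sqrt (by linarith)]
  have h3 : (p + k) * (2 * lam ^ 2 * k + b ^ 2) ≤ (p + k) * (C ^ 2 * lam ^ 2 * k) :=
    mul_le_mul_of_nonneg_left h (by linarith)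
  have h4 : k * (√2 * lam * √p + b) ^ 2 =
      k * (2 * lam ^ 2 * p + 2 * (√2 * lam * √p * b) + b ^ 2) := by
    rw [add_sq, mul_pow, mul_pow, h2, hp2]; ring
  have h5 : (√2 * lam * k - √p * b) ^ 2 =
      2 * lam ^ 2 * k ^ 2 - 2 * k * (√2 * lam * √p * b) + p * b ^ 2 := by
    rw [sub_sq, mul_pow, mul_pow, mul_pow, h2, hp2]; ring
  have h6 := sq_nonneg (√2 * lam * k - √p * b)
  rw [h5] at h6
  refine le_of_mul_le_mul_left ?_ hk
  rw [h4]
  nlinarith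

namespace RoundingSetting

variable {m n : ℕ} {u lam : ℝ}

lemma one_le_cast (h : RoundingSetting m n u lam) : (1 : ℝ) ≤ n := by exact_mod_cast h.one_le

lemma one_le_cast_m (h : RoundingSetting m n u lam) : (1 : ℝ) ≤ m := by
  exact_mod_cast h.one_le.trans h.le

lemma u_le (h : RoundingSetting m n u lam) : u ≤ 1 / 4400 := by
  have h1 := h.size_nn
  have h2 := h.one_le_cast
  have h3 : (2 : ℝ) ≤ n * (n + 1) := by nlinarith
  nlinarith [h.u_pos]

lemma lam_ge (h : RoundingSetting m n u lam) : 1.177 ≤ lam :=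
  abs_le_of_sq_le_sq' (by linarith [h.lam_sq]) h.lam_pos.le |>.2

lemma gram_const (h : RoundingSetting m n u lam) :
    1.002 * (√2 * lam * √(m - 1) * u + (m - 1) * (2 * u ^ 2) + (u + 2 * u ^ 2)) ≤
      1.67 * lam * √m * u := by
  have hm := h.one_le_cast_m
  have hu := h.u_pos
  have h1 : (m : ℝ) * u ≤ 1 / 2200 := by
    refine le_trans ?_ h.size_mn
    have : (m : ℝ) * 1 ≤ m * n := mul_le_mul_of_nonneg_left h.one_le_cast (by linarith)
    nlinarith
  have h2 := sqrt_two_mul_add_le (b := 1.001) (C := 1.666) (p := m - 1) (k := 1) h.lam_pos.le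
    (by linarith) one_pos (by norm_num) (by linarith [h.lam_sq])
  rw [sub_add_cancel] at h2
  have h3 := mul_le_mul_of_nonneg_right h2 hu.le
  have h4 : 0 ≤ lam * √m * u := by have := h.lam_pos; positivity
  nlinarith

lemma solve_const (h : RoundingSetting m n u lam) :
    1.002 * (√2 * lam * √(n - 1) * u + (n - 1) * (2 * u ^ 2) + (u + 2 * u ^ 2)) ≤
      1.67 * lam * √n * u := by
  have hn := h.one_le_cast
  have hu := h.u_pos
  have h1 : (n : ℝ) * u ≤ 1 / 2200 := by
    exact (mul_le_mul_of_nonneg_right (by nlinarith) hu.le).trans h.size_nn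
  have h2 := sqrt_two_mul_add_le (b := 1.001) (C := 1.666) (p := n - 1) (k := 1) h.lam_pos.le
    (by linarith) one_pos (by norm_num) (by linarith [h.lam_sq])
  rw [sub_add_cancel] at h2
  have h3 := mul_le_mul_of_nonneg_right h2 hu.le
  have h4 : 0 ≤ lam * √n * u := by have := h.lam_pos; positivity
  nlinarith

lemma chol_const (h : RoundingSetting m n u lam) :
    1.002 * (√2 * lam * √(n - 1) * u + (n - 1) * (2 * u ^ 2) + 2 * (u + 2 * u ^ 2)) ≤
      1.88 * lam * √(n + 1) * u := by
  have hn := h.one_le_cast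
  have hu := h.u_pos
  have h1 : ((n : ℝ) + 1) * u ≤ 1 / 2200 := by
    exact (mul_le_mul_of_nonneg_right (by nlinarith) hu.le).trans h.size_nn
  have h2 := sqrt_two_mul_add_le (b := 2.001) (C := 1.876) (p := n - 1) (k := 2) h.lam_pos.le
    (by linarith) two_pos (by norm_num) (by linarith [h.lam_sq])
  rw [show (n : ℝ) - 1 + 2 = n + 1 by ring] at h2
  have h3 := mul_le_mul_of_nonneg_right h2 hu.le
  have h4 : 0 ≤ lam * √(n + 1) * u := by have := h.lam_pos; positivity
  nlinarith

lemma gram_small (h : RoundingSetting m n u lam) : 1.67 * lam * √m * u ≤ 0.00076 := by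
  have h1 := h.size_m
  have h4 : 0 ≤ lam * √m * u := by have := h.lam_pos; have := h.u_pos; positivity
  nlinarith [h.one_le_cast]

lemma chol_small (h : RoundingSetting m n u lam) : 1.88 * lam * √(n + 1) * u ≤ 0.00086 := by
  have h1 := h.size_n
  have h4 : 0 ≤ lam * √(n + 1) * u := by have := h.lam_pos; have := h.u_pos; positivity
  nlinarith [h.one_le_cast]

lemma sqrt_n_le (h : RoundingSetting m n u lam) :
    lam * √n * n * u ≤ lam * √(n + 1) * n * u := by
  have := h.lam_pos
  have := h.u_pos
  gcongr
  linarith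

/-- The rounding errors of the shift are a fraction of `λ S`. -/
lemma n_mul_u_le (h : RoundingSetting m n u lam) :
    n * u ≤ 0.36 * (lam * √m * n * u + lam * √(n + 1) * n * u) := by
  have hm : 1 ≤ √(m : ℝ) := Real.one_le_sqrt.2 h.one_le_cast_m
  have hn : 1.414 ≤ √((n : ℝ) + 1) := by
    refine Real.le_sqrt_of_sq_le ?_
    linarith [h.one_le_cast]
  have hl := h.lam_ge
  have h1 : 1.177 * 2.414 ≤ lam * (√m + √(n + 1)) :=
    mul_le_mul hl (by linarith) (by norm_num) (by linarith)
  have h2 : 0 ≤ (n : ℝ) * u := by have := h.u_pos; positivity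
  nlinarith

lemma alpha_le (h : RoundingSetting m n u lam) :
    lam * √m * n * u + lam * √(n + 1) * n * u ≤ 1 / 1100 := by
  linarith [h.size_m, h.size_n]

lemma alpha_pos (h : RoundingSetting m n u lam) :
    0 < lam * √m * n * u + lam * √(n + 1) * n * u := by
  have := h.lam_pos
  have := h.u_pos
  have := h.one_le_cast
  positivity

end RoundingSetting

section Sweep

variable {m n : ℕ} {u lam s : ℝ} {δ : FlOp → ℝ} {b : ℕ}

/-- The error bounds of one sweep: the Cholesky factorization of a computed `Aᵀ A + s I`, followed
by the triangular substitution. -/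
structure SweepBounds (A Q : Matrix (Fin m) (Fin n) ℝ) (V : Matrix (Fin n) (Fin n) ℝ)
    (s u lam : ℝ) : Prop where
  gram : ∀ x : EuclideanSpace ℝ (Fin n), |‖Matrix.toEuclideanLin V x‖ ^ 2 -
    (‖Matrix.toEuclideanLin A x‖ ^ 2 + s * ‖x‖ ^ 2)| ≤
      2.3 * (lam * √m * n * u + lam * √(n + 1) * n * u) * gNorm A ^ 2 * ‖x‖ ^ 2
  residual : ∀ x : EuclideanSpace ℝ (Fin n), ‖Matrix.toEuclideanLin A x -
    Matrix.toEuclideanLin Q (Matrix.toEuclideanLin V x)‖ ≤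
      1.69 * (lam * √n * n * u) * gNorm A * gNorm Q * ‖x‖

theorem sweep_spec (h : RoundingSetting m n u lam) {stepC stepS : ℕ}
    (hC : SmallPrefixSums δ u (√2 * lam * √(n - 1) * u) stepC n n)
    (hS : SmallPrefixSums δ u (√2 * lam * √(n - 1) * u) stepS m n)
    {A : Matrix (Fin m) (Fin n) ℝ} {U : Matrix (Fin n) (Fin n) ℝ} (hA : 0 < gNorm A)
    (hs : s ≤ gNorm A ^ 2 / 100)
    (hU : ∀ i j, i ≤ j → |U i j - (∑ k, A k i * A k j + if i = j then s else 0)| ≤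
      (1.67 * lam * √m * u + 1.02 * u) * gNorm A ^ 2)
    (hlow : ∀ x : EuclideanSpace ℝ (Fin n),
      10 * (lam * √m * n * u + lam * √(n + 1) * n * u) * gNorm A ^ 2 * ‖x‖ ^ 2 ≤
        ‖Matrix.toEuclideanLin A x‖ ^ 2 + s * ‖x‖ ^ 2) :
    FlCholeskyCompletes δ stepC U ∧
      SweepBounds A (flSolve δ stepS A (flCholesky δ stepC U)) (flCholesky δ stepC U) s u lam := by
  have hu5 : u ≤ 1 / 5 := by linarith [h.u_le]
  have hu := h.u_pos
  have hl := h.lam_pos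
  have hn := h.one_le_cast
  set g := gNorm A with hg
  have hg2 : 0 < g ^ 2 := by positivity
  have hτ : 0 ≤ √2 * lam * √(n - 1) * u := by positivity
  have hn1 : 0 ≤ ((n : ℝ) - 1) * (2 * u ^ 2) := mul_nonneg (by linarith) (by positivity)
  have hcc := h.chol_const
  have hsc := h.solve_const
  have hcs := h.chol_small
  have hgs := h.gram_small
  have hnu := h.n_mul_u_le
  have hule := h.u_le
  have hα := h.alpha_pos
  have hS1 : 0 ≤ lam * √m * n * u := by positivity
  have hS2 : 0 ≤ lam * √(n + 1) * n * u := by positivity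
  have hsqn := h.sqrt_n_le
  have hγs : 1.67 * lam * √n * u ≤ 0.00086 := by
    have h4 : 0 ≤ lam * √n * u := by positivity
    nlinarith [h.size_n]
  have hu2 : 0 ≤ u + 2 * u ^ 2 := by positivity
  have hspec := flCholesky_spec (A := A) (U := U) (s := s)
    (μ := 10 * (lam * √m * n * u + lam * √(n + 1) * n * u) * g ^ 2)
    (f := (1.67 * lam * √m * u + 1.02 * u) * g ^ 2) (H := 1.0111 * g ^ 2)
    (γ := 1.88 * lam * √(n + 1) * u)
    hC hu5 rfl (by linarith) (by linarith) hcc (by linarith) (by positivity) (by positivity)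
    hU ?_ hlow ?_
  · obtain ⟨h1, h2, h3⟩ := hspec
    refine ⟨h1, fun x => (h3 x).trans ?_, fun x => ?_⟩
    · refine mul_le_mul_of_nonneg_right ?_ (sq_nonneg _)
      rw [show n * ((1.67 * lam * √m * u + 1.02 * u) * g ^ 2 +
        1.88 * lam * √(n + 1) * u * (1.001 * (1.0111 * g ^ 2))) =
        (1.67 * (lam * √m * n * u) + 1.02 * (n * u) +
          1.88 * 1.001 * 1.0111 * (lam * √(n + 1) * n * u)) * g ^ 2 by ring]
      exact mul_le_mul_of_nonneg_right (by linarith) hg2.le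
    · have h4 := norm_sub_flSolve_le (γ := 1.67 * lam * √n * u) (v := 1.0061 * g)
        (q := gNorm (flSolve δ stepS A (flCholesky δ stepC U)))
        hS hu5 rfl (by linarith) (by linarith) hsc A
        (flCholesky_diag_ne_zero hC hu5 h1) (fun i j hij => flCholesky_lower U hij)
        (by positivity) (gNorm_nonneg _) (fun j => (h2 j).trans (by nlinarith))
        (fun j => sum_sq_le_gNorm_sq _ j) x
      refine h4.trans (mul_le_mul_of_nonneg_right ?_ (norm_nonneg _))
      have h5 : 0 ≤ lam * √n * n * u * g * gNorm (flSolve δ stepS A (flCholesky δ stepC U)) :=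
        mul_nonneg (by positivity) (gNorm_nonneg _)
      nlinarith
  · intro j
    have h1 := sum_sq_le_gNorm_sq A j
    have h2 : (1.67 * lam * √m * u + 1.02 * u) * g ^ 2 ≤ 0.001 * g ^ 2 :=
      mul_le_mul_of_nonneg_right (by linarith) hg2.le
    rw [← hg] at h1
    linarith
  · rw [show n * ((1.67 * lam * √m * u + 1.02 * u) * g ^ 2 +
        4 * (1.88 * lam * √(n + 1) * u) * (1.0111 * g ^ 2)) =
        (1.67 * (lam * √m * n * u) + 1.02 * (n * u) +
          4 * 1.88 * 1.0111 * (lam * √(n + 1) * n * u)) * g ^ 2 by ring]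
    exact mul_lt_mul_of_pos_right (by linarith) hg2

lemma abs_gram_sub_le (h : RoundingSetting m n u lam) {step : ℕ}
    (hG : SmallSuffixSums δ u (√2 * lam * √(m - 1) * u) step n m)
    (A : Matrix (Fin m) (Fin n) ℝ) (i j : Fin n) :
    |flMatMul δ step A.transpose A i j - ∑ k, A k i * A k j| ≤
      1.67 * lam * √m * u * gNorm A ^ 2 := by
  have hu := h.u_pos
  have hl := h.lam_pos
  have hm := h.one_le_cast_m
  have hgc := h.gram_const
  have hgs := h.gram_small
  have hτ : 0 ≤ √2 * lam * √(m - 1) * u := by positivity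
  have hm1 : 0 ≤ ((m : ℝ) - 1) * (2 * u ^ 2) := mul_nonneg (by linarith) (by positivity)
  have hu2 : 0 ≤ u + 2 * u ^ 2 := by positivity
  refine (abs_flMatMul_transpose_sub_le hG (by linarith [h.u_le]) rfl (by linarith) (by linarith)
    hgc A i j).trans (mul_le_mul_of_nonneg_left ?_ (by positivity))
  rw [sq]
  exact mul_le_mul (sqrt_sum_sq_le_gNorm A i) (sqrt_sum_sq_le_gNorm A j) (Real.sqrt_nonneg _)
    (gNorm_nonneg A)

/-- Shifted CholeskyQR completes for every matrix when the shift is `11 λ S ‖A‖_g²`. -/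
theorem flSCholeskyQR_spec (h : RoundingSetting m n u lam)
    (hG : SmallSuffixSums δ u (√2 * lam * √(m - 1) * u) 0 n m)
    (hC : SmallPrefixSums δ u (√2 * lam * √(n - 1) * u) 2 n n)
    (hS : SmallPrefixSums δ u (√2 * lam * √(n - 1) * u) 3 m n)
    {A : Matrix (Fin m) (Fin n) ℝ} (hA : 0 < gNorm A)
    (hs : s = 11 * (lam * √m * n * u + lam * √(n + 1) * n * u) * gNorm A ^ 2) :
    (flSCholeskyQR δ s A).completes ∧
      SweepBounds A (flSCholeskyQR δ s A).Q (flSCholeskyQR δ s A).V s u lam := by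
  have hα := h.alpha_pos
  have hg2 : 0 < gNorm A ^ 2 := by positivity
  have hs0 : 0 ≤ s := by rw [hs]; positivity
  have hs1 : s ≤ gNorm A ^ 2 / 100 := by
    rw [hs]; nlinarith [h.alpha_le]
  refine sweep_spec h hC hS hA hs1 (fun i j _ => ?_) fun x => ?_
  · have h1 := abs_gram_sub_le h hG A i j
    have hu := h.u_pos
    simp only [flShift, Matrix.of_apply]
    split_ifs with hij
    · subst hij
      set U := flMatMul δ 0 A.transpose A i i
      have h2 := sum_sq_le_gNorm_sq A i
      simp_rw [← sq] at h1 ⊢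
      have h0 : 0 ≤ ∑ k, A k i ^ 2 := by positivity
      have h3 : |U + s| ≤ 1.02 * gNorm A ^ 2 := by
        have h4 := mul_le_mul_of_nonneg_right h.gram_small hg2.le
        obtain ⟨h5, h6⟩ := abs_le.1 h1
        rw [abs_le]
        constructor <;> linarith
      have h4 : |δ (.add 1 i i 0) * (U + s)| ≤ u * (1.02 * gNorm A ^ 2) := by
        rw [abs_mul]
        exact mul_le_mul (hG.bound _) h3 (abs_nonneg _) hu.le
      have h5 := abs_add_le (U - ∑ k, A k i ^ 2) (δ (.add 1 i i 0) * (U + s))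
      rw [show (U + s) * (1 + δ (.add 1 i i 0)) - (∑ k, A k i ^ 2 + s) =
        U - ∑ k, A k i ^ 2 + δ (.add 1 i i 0) * (U + s) by ring]
      linarith
    · rw [add_zero]
      have : 0 ≤ u * gNorm A ^ 2 := by positivity
      linarith
  · have h1 : 0 ≤ (lam * √m * n * u + lam * √(n + 1) * n * u) * gNorm A ^ 2 * ‖x‖ ^ 2 := by
      positivity
    have h2 := sq_nonneg ‖Matrix.toEuclideanLin A x‖
    rw [hs]
    linarith

/-- CholeskyQR completes for a matrix that is not too ill-conditioned. -/
theorem flCholeskyQR_spec (h : RoundingSetting m n u lam)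
    (hG : SmallSuffixSums δ u (√2 * lam * √(m - 1) * u) b n m)
    (hC : SmallPrefixSums δ u (√2 * lam * √(n - 1) * u) (b + 1) n n)
    (hS : SmallPrefixSums δ u (√2 * lam * √(n - 1) * u) (b + 2) m n)
    {A : Matrix (Fin m) (Fin n) ℝ} (hA : 0 < gNorm A)
    (hσ : 64 * (lam * √m * n * u + lam * √(n + 1) * n * u) * gNorm A ^ 2 ≤ sigmaMin A ^ 2) :
    (flCholeskyQR δ b A).completes ∧
      SweepBounds A (flCholeskyQR δ b A).Q (flCholeskyQR δ b A).V 0 u lam := by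
  have hα := h.alpha_pos
  have hg2 : 0 < gNorm A ^ 2 := by positivity
  refine sweep_spec h hC hS hA (by positivity) (fun i j _ => ?_) fun x => ?_
  · have h1 := abs_gram_sub_le h hG A i j
    have : 0 ≤ u * gNorm A ^ 2 := by have := h.u_pos; positivity
    simp only [ite_self, add_zero]
    linarith
  · have h1 := pow_le_pow_left₀ (mul_nonneg (sigmaMin_nonneg A) (norm_nonneg x))
      (sigmaMin_mul_norm_le A x) 2
    rw [mul_pow] at h1
    have h2 := mul_le_mul_of_nonneg_right hσ (sq_nonneg ‖x‖)
    have h3 : 0 ≤ (lam * √m * n * u + lam * √(n + 1) * n * u) * gNorm A ^ 2 * ‖x‖ ^ 2 := by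
      positivity
    linarith

end Sweep

/-! ### Perturbation bounds for the condition numbers -/

section Perturbation

variable {m n : ℕ} {u lam s : ℝ} {A Q : Matrix (Fin m) (Fin n) ℝ} {V : Matrix (Fin n) (Fin n) ℝ}

/-- A square factor that does not annihilate any nonzero vector is onto. -/
lemma exists_toEuclideanLin_eq {c : ℝ} (hc : 0 < c)
    (hV : ∀ x : EuclideanSpace ℝ (Fin n), c * ‖x‖ ^ 2 ≤ ‖Matrix.toEuclideanLin V x‖ ^ 2)
    (z : EuclideanSpace ℝ (Fin n)) : ∃ x, Matrix.toEuclideanLin V x = z := by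
  refine LinearMap.surjective_of_injective ?_ z
  refine (injective_iff_map_eq_zero _).2 fun x hx => ?_
  have h1 := hV x
  rw [hx, norm_zero] at h1
  have h2 : ‖x‖ ^ 2 ≤ 0 := by nlinarith [sq_nonneg ‖x‖]
  exact norm_eq_zero.1 (pow_eq_zero_iff two_ne_zero |>.1 (le_antisymm h2 (sq_nonneg _)))

/-- The computed factor of Shifted CholeskyQR has norm close to `1` at most. -/
lemma SweepBounds.norm2_le_of_shift (h : RoundingSetting m n u lam) (hA : 0 < gNorm A)
    (hs : s = 11 * (lam * √m * n * u + lam * √(n + 1) * n * u) * gNorm A ^ 2)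
    (hb : SweepBounds A Q V s u lam) : norm2 Q ≤ 1.018 := by
  have hgr := hb.gram
  have hre := hb.residual
  set α := lam * √m * n * u + lam * √(n + 1) * n * u with hαdef
  set g := gNorm A
  have hα : 0 < α := h.alpha_pos
  have hα1 : α ≤ 1 / 1100 := h.alpha_le
  have hβ : lam * √n * n * u ≤ α := by
    have h1 := h.sqrt_n_le
    have : 0 ≤ lam * √m * n * u := by have := h.lam_pos; have := h.u_pos; positivity
    linarith
  have hβ0 : 0 ≤ lam * √n * n * u := by have := h.lam_pos; have := h.u_pos; positivity
  have hN := norm2_nonneg Q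
  have hVlow : ∀ x : EuclideanSpace ℝ (Fin n),
      ‖Matrix.toEuclideanLin A x‖ ^ 2 + 8.7 * α * g ^ 2 * ‖x‖ ^ 2 ≤
        ‖Matrix.toEuclideanLin V x‖ ^ 2 := by
    intro x
    have h1 := (abs_le.1 (hgr x)).1
    rw [hs] at h1
    linarith
  have key : norm2 Q ≤ 1 + 0.0174 * norm2 Q := by
    refine norm2_le (by linarith) fun z => ?_
    obtain ⟨x, rfl⟩ := exists_toEuclideanLin_eq (V := V) (c := 8.7 * α * g ^ 2) (by positivity)
      (fun x => by linarith [hVlow x, sq_nonneg ‖Matrix.toEuclideanLin A x‖]) z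
    set z := Matrix.toEuclideanLin V x with hz
    have hre' := hre x
    rw [← hz] at hre'
    have h1 := hVlow x
    rw [← hz] at h1
    have hAx : ‖Matrix.toEuclideanLin A x‖ ≤ ‖z‖ := by
      refine abs_le_of_sq_le_sq' ?_ (norm_nonneg _) |>.2
      have : 0 ≤ 8.7 * α * g ^ 2 * ‖x‖ ^ 2 := by positivity
      linarith
    have hx : 8.7 * α * (g * ‖x‖) ^ 2 ≤ ‖z‖ ^ 2 := by
      linarith [sq_nonneg ‖Matrix.toEuclideanLin A x‖]
    have hαgx : 1.69 * α * (g * ‖x‖) ≤ 0.0174 * ‖z‖ := by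
      refine abs_le_of_sq_le_sq' ?_ (by positivity) |>.2
      have h2 : α * (α * (g * ‖x‖) ^ 2) ≤ 1 / 1100 * (α * (g * ‖x‖) ^ 2) :=
        mul_le_mul_of_nonneg_right hα1 (by positivity)
      linarith [sq_nonneg ‖z‖]
    have h4 : 1.69 * (lam * √n * n * u) * g * gNorm Q * ‖x‖ ≤ 0.0174 * norm2 Q * ‖z‖ := by
      calc 1.69 * (lam * √n * n * u) * g * gNorm Q * ‖x‖
          = gNorm Q * (1.69 * (lam * √n * n * u) * (g * ‖x‖)) := by ring
        _ ≤ norm2 Q * (1.69 * α * (g * ‖x‖)) := by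
            refine mul_le_mul (gNorm_le_norm2 Q) ?_ (by positivity) hN
            gcongr
        _ ≤ norm2 Q * (0.0174 * ‖z‖) := mul_le_mul_of_nonneg_left hαgx hN
        _ = _ := by ring
    have h5 := norm_sub_norm_le (Matrix.toEuclideanLin Q z) (Matrix.toEuclideanLin A x)
    rw [norm_sub_rev] at h5
    linarith
  linarith

/-- The computed factor of Shifted CholeskyQR is well-conditioned: the shift costs the factor
`√(1 + s / σ_min(A)²)`, and the residual of the substitution at most a third of `‖A x‖`. -/
lemma SweepBounds.le_sigmaMin_of_shift (h : RoundingSetting m n u lam) (hA : 0 < gNorm A)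
    (hs : s = 11 * (lam * √m * n * u + lam * √(n + 1) * n * u) * gNorm A ^ 2)
    (hb : SweepBounds A Q V s u lam) (hσ : 0 < sigmaMin A)
    (hcond : 4.89 * (lam * √n * n * u) * gNorm A * gNorm Q ≤ sigmaMin A * norm2 Q) :
    0.589 ≤ sigmaMin Q * √(1 + s / sigmaMin A ^ 2) := by
  have hgr := hb.gram
  have hre := hb.residual
  have hN := hb.norm2_le_of_shift h hA hs
  set α := lam * √m * n * u + lam * √(n + 1) * n * u with hαdef
  set g := gNorm A
  set σ := sigmaMin A
  have hα : 0 < α := h.alpha_pos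
  have hs0 : 0 ≤ s := by rw [hs]; positivity
  set y := √(1 + s / σ ^ 2) with hy
  have hy2 : y ^ 2 = 1 + s / σ ^ 2 := Real.sq_sqrt (by positivity)
  have hy0 : 0 < y := Real.sqrt_pos.2 (by positivity)
  have hr : 1.69 * (lam * √n * n * u) * g * gNorm Q ≤ 0.352 * σ := by
    have : σ * norm2 Q ≤ σ * 1.018 := mul_le_mul_of_nonneg_left hN hσ.le
    linarith
  suffices hmain : 0.589 / y ≤ sigmaMin Q by
    rwa [div_le_iff₀ hy0] at hmain
  refine le_sigmaMin h.one_le fun z => ?_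
  obtain ⟨x, rfl⟩ := exists_toEuclideanLin_eq (V := V) (c := 8.7 * α * g ^ 2) (by positivity)
    (fun x => by
      have h1 := (abs_le.1 (hgr x)).1
      rw [hs] at h1
      linarith [sq_nonneg ‖Matrix.toEuclideanLin A x‖]) z
  set z := Matrix.toEuclideanLin V x with hzdef
  have hσx := sigmaMin_mul_norm_le A x
  have hz : ‖z‖ ≤ 1.1 * y * ‖Matrix.toEuclideanLin A x‖ := by
    refine abs_le_of_sq_le_sq' ?_ (by positivity) |>.2
    have h1 := (abs_le.1 (hgr x)).2
    rw [← hzdef] at h1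
    have h2 : s * ‖x‖ ^ 2 ≤ s / σ ^ 2 * ‖Matrix.toEuclideanLin A x‖ ^ 2 := by
      have h3 : σ ^ 2 * ‖x‖ ^ 2 ≤ ‖Matrix.toEuclideanLin A x‖ ^ 2 := by
        rw [← mul_pow]
        exact pow_le_pow_left₀ (by positivity) hσx 2
      calc s * ‖x‖ ^ 2 = s / σ ^ 2 * (σ ^ 2 * ‖x‖ ^ 2) := by field_simp
        _ ≤ _ := mul_le_mul_of_nonneg_left h3 (by positivity)
    have h4 : 2.3 * α * g ^ 2 * ‖x‖ ^ 2 = 2.3 / 11 * (s * ‖x‖ ^ 2) := by rw [hs]; ring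
    rw [h4] at h1
    rw [mul_pow, mul_pow, hy2]
    have h5 := sq_nonneg ‖Matrix.toEuclideanLin A x‖
    have h6 : 0 ≤ s / σ ^ 2 * ‖Matrix.toEuclideanLin A x‖ ^ 2 := by positivity
    linarith
  have h3 := hre x
  rw [← hzdef] at h3
  have h4 : 1.69 * (lam * √n * n * u) * g * gNorm Q * ‖x‖ ≤
      0.352 * ‖Matrix.toEuclideanLin A x‖ := by
    have := mul_le_mul_of_nonneg_right hr (norm_nonneg x)
    linarith
  have h5 := norm_sub_norm_le (Matrix.toEuclideanLin A x) (Matrix.toEuclideanLin Q z)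
  rw [div_mul_eq_mul_div, div_le_iff₀ hy0]
  have h6 : 0.648 * ‖Matrix.toEuclideanLin A x‖ ≤ ‖Matrix.toEuclideanLin Q z‖ := by linarith
  have h7 := mul_le_mul_of_nonneg_left h6 hy0.le
  have h8 : 0 ≤ y * ‖Matrix.toEuclideanLin A x‖ := by positivity
  linarith

/-- One sweep of CholeskyQR on a matrix that is not too ill-conditioned gives a nearly orthogonal
factor. -/
lemma SweepBounds.nearly_orthogonal (h : RoundingSetting m n u lam) (hA : 0 < gNorm A)
    (hσ : 64 * (lam * √m * n * u + lam * √(n + 1) * n * u) * gNorm A ^ 2 ≤ sigmaMin A ^ 2)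
    (hb : SweepBounds A Q V 0 u lam) : norm2 Q ≤ 1.03 ∧ 0.97 ≤ sigmaMin Q := by
  have hgr := hb.gram
  have hre := hb.residual
  set α := lam * √m * n * u + lam * √(n + 1) * n * u with hαdef
  set g := gNorm A
  set σ := sigmaMin A with hσdef
  have hα : 0 < α := h.alpha_pos
  have hα1 : α ≤ 1 / 1100 := h.alpha_le
  have hσ0 : 0 ≤ σ := sigmaMin_nonneg A
  have hβ : lam * √n * n * u ≤ α := by
    have h1 := h.sqrt_n_le
    have : 0 ≤ lam * √m * n * u := by have := h.lam_pos; have := h.u_pos; positivity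
    linarith
  have hβ0 : 0 ≤ lam * √n * n * u := by have := h.lam_pos; have := h.u_pos; positivity
  have hN := norm2_nonneg Q
  have hσx : ∀ x, 64 * α * g ^ 2 * ‖x‖ ^ 2 ≤ ‖Matrix.toEuclideanLin A x‖ ^ 2 := fun x => by
    refine (mul_le_mul_of_nonneg_right hσ (sq_nonneg ‖x‖)).trans ?_
    rw [← mul_pow]
    exact pow_le_pow_left₀ (by positivity) (sigmaMin_mul_norm_le A x) 2
  have hgram : ∀ x, |‖Matrix.toEuclideanLin V x‖ ^ 2 - ‖Matrix.toEuclideanLin A x‖ ^ 2| ≤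
      0.036 * ‖Matrix.toEuclideanLin A x‖ ^ 2 := fun x => by
    have h1 := hgr x
    rw [zero_mul, add_zero] at h1
    refine h1.trans ?_
    linarith [hσx x, sq_nonneg ‖Matrix.toEuclideanLin A x‖]
  have hres : ∀ x, ‖Matrix.toEuclideanLin A x -
      Matrix.toEuclideanLin Q (Matrix.toEuclideanLin V x)‖ ≤
        0.0064 * norm2 Q * ‖Matrix.toEuclideanLin A x‖ := fun x => by
    have h2 : 1.69 * α * (g * ‖x‖) ≤ 0.0064 * ‖Matrix.toEuclideanLin A x‖ := by
      refine abs_le_of_sq_le_sq' ?_ (by positivity) |>.2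
      have h3 : α * (α * (g * ‖x‖) ^ 2) ≤ 1 / 1100 * (α * (g * ‖x‖) ^ 2) :=
        mul_le_mul_of_nonneg_right hα1 (by positivity)
      linarith [hσx x, sq_nonneg ‖Matrix.toEuclideanLin A x‖]
    refine (hre x).trans ?_
    calc 1.69 * (lam * √n * n * u) * g * gNorm Q * ‖x‖
        = gNorm Q * (1.69 * (lam * √n * n * u) * (g * ‖x‖)) := by ring
      _ ≤ norm2 Q * (1.69 * α * (g * ‖x‖)) := by
          refine mul_le_mul (gNorm_le_norm2 Q) ?_ (by positivity) hN
          gcongr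
      _ ≤ norm2 Q * (0.0064 * ‖Matrix.toEuclideanLin A x‖) := mul_le_mul_of_nonneg_left h2 hN
      _ = _ := by ring
  have hsurj := exists_toEuclideanLin_eq (V := V) (c := 60 * α * g ^ 2) (by positivity)
    (fun x => by
      have h1 := (abs_le.1 (hgram x)).1
      have h2 := hσx x
      have h3 : 0 ≤ α * g ^ 2 * ‖x‖ ^ 2 := by positivity
      linarith)
  have hnorm : norm2 Q ≤ 1.03 := by
    have key : norm2 Q ≤ 1.0186 * (1 + 0.0064 * norm2 Q) := by
      refine norm2_le (by linarith) fun z => ?_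
      obtain ⟨x, rfl⟩ := hsurj z
      have hAx : ‖Matrix.toEuclideanLin A x‖ ≤ 1.0186 * ‖Matrix.toEuclideanLin V x‖ := by
        refine abs_le_of_sq_le_sq' ?_ (by positivity) |>.2
        have h1 := (abs_le.1 (hgram x)).1
        have h2 := sq_nonneg ‖Matrix.toEuclideanLin A x‖
        rw [mul_pow]
        linarith
      have h3 := hres x
      have h5 := norm_sub_norm_le (Matrix.toEuclideanLin Q (Matrix.toEuclideanLin V x))
        (Matrix.toEuclideanLin A x)
      rw [norm_sub_rev] at h5
      have h6 := mul_le_mul_of_nonneg_left hAx (show 0 ≤ 1 + 0.0064 * norm2 Q by linarith)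
      linarith
    linarith
  refine ⟨hnorm, le_sigmaMin h.one_le fun z => ?_⟩
  obtain ⟨x, rfl⟩ := hsurj z
  have hVx : ‖Matrix.toEuclideanLin V x‖ ≤ 1.0179 * ‖Matrix.toEuclideanLin A x‖ := by
    refine abs_le_of_sq_le_sq' ?_ (by positivity) |>.2
    have h1 := (abs_le.1 (hgram x)).2
    have h2 := sq_nonneg ‖Matrix.toEuclideanLin A x‖
    rw [mul_pow]
    linarith
  have h3 := hres x
  have h5 := norm_sub_norm_le (Matrix.toEuclideanLin A x)
    (Matrix.toEuclideanLin Q (Matrix.toEuclideanLin V x))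
  have h6 := mul_le_mul_of_nonneg_right hnorm (norm_nonneg (Matrix.toEuclideanLin A x))
  linarith [norm_nonneg (Matrix.toEuclideanLin A x)]

end Perturbation

/-- The rounding errors of a run of Shifted CholeskyQR3 are small: every single one is at most `u`,
and sums of consecutive errors of the additions in an inner product, a Cholesky factorization or
a triangular substitution are as small as sums of independent errors typically are. -/
structure SmallRunErrors (δ : FlOp → ℝ) (u lam : ℝ) (m n : ℕ) : Prop where
  gram : ∀ step ∈ ({0, 4, 8} : Finset ℕ),
    SmallSuffixSums δ u (√2 * lam * √(m - 1) * u) step n m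
  chol : ∀ step ∈ ({2, 5, 9} : Finset ℕ),
    SmallPrefixSums δ u (√2 * lam * √(n - 1) * u) step n n
  solve : ∀ step ∈ ({3, 6, 10} : Finset ℕ),
    SmallPrefixSums δ u (√2 * lam * √(n - 1) * u) step m n

section Run

variable {m n : ℕ} {u lam s t : ℝ} {δ : FlOp → ℝ} {T : Matrix (Fin m) (Fin n) ℝ}

lemma norm2_pos_of_gNorm_pos (h : 0 < gNorm T) : 0 < norm2 T := h.trans_le (gNorm_le_norm2 T)

lemma pRatio_mul_kappa2 (h : 0 < gNorm T) : pRatio T * kappa2 T = gNorm T / sigmaMin T := by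
  have := (norm2_pos_of_gNorm_pos h).ne'
  rw [pRatio, kappa2]
  field_simp

lemma div_sq_mul_kappa2_sq (h : 0 < gNorm T) :
    s / norm2 T ^ 2 * kappa2 T ^ 2 = s / sigmaMin T ^ 2 := by
  have := (norm2_pos_of_gNorm_pos h).ne'
  rw [kappa2]
  field_simp

/-- The condition number of the computed factor of Shifted CholeskyQR. -/
theorem kappa2_flSCholeskyQR_le (h : RoundingSetting m n u lam) (hδ : SmallRunErrors δ u lam m n)
    (hσ : 0 < sigmaMin T)
    (hs : s = 11 * (lam * √m * n * u + lam * √(n + 1) * n * u) * gNorm T ^ 2)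
    (ht : t = s / norm2 T ^ 2)
    (hcond : 4.89 * pRatio T * pRatio (flSCholeskyQR δ s T).Q * lam * n * √n * u * kappa2 T ≤ 1) :
    0 < sigmaMin (flSCholeskyQR δ s T).Q ∧
      kappa2 (flSCholeskyQR δ s T).Q ≤ 1.73 * √(1 + t * kappa2 T ^ 2) := by
  have hg : 0 < gNorm T := hσ.trans_le (sigmaMin_le_gNorm h.one_le T)
  have hb := (flSCholeskyQR_spec h (hδ.gram 0 (by simp)) (hδ.chol 2 (by simp))
    (hδ.solve 3 (by simp)) hg hs).2
  set Q := (flSCholeskyQR δ s T).Q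
  have hN := hb.norm2_le_of_shift h hg hs
  have h1 := hb.le_sigmaMin_of_shift h hg hs hσ (by
    have h2 : 4.89 * pRatio T * pRatio Q * lam * n * √n * u * kappa2 T =
        4.89 * (lam * √n * n * u) * pRatio Q * gNorm T / sigmaMin T := by
      rw [mul_div_assoc, ← pRatio_mul_kappa2 hg]
      ring
    rw [h2, div_le_one hσ] at hcond
    have h3 := mul_le_mul_of_nonneg_right hcond (norm2_nonneg Q)
    rw [← pRatio_mul_norm2 Q]
    linarith)
  have hσQ : 0 < sigmaMin Q := by
    refine lt_of_le_of_ne (sigmaMin_nonneg Q) fun h0 => ?_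
    rw [← h0, zero_mul] at h1
    norm_num at h1
  refine ⟨hσQ, ?_⟩
  rw [ht, div_sq_mul_kappa2_sq hg, kappa2, div_le_iff₀ hσQ]
  linarith

/-- If `κ₂(T)` meets the condition for Shifted CholeskyQR3, then the factor of the first sweep
meets the condition for CholeskyQR2. -/
theorem cholesky2_condition (h : RoundingSetting m n u lam) (hδ : SmallRunErrors δ u lam m n)
    (hσ : 0 < sigmaMin T)
    (hs : s = 11 * (lam * √m * n * u + lam * √(n + 1) * n * u) * gNorm T ^ 2)
    (hcond : 86 * (lam * √m * n * u + lam * √(n + 1) * n * u) * pRatio T *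
      pRatio (flSCholeskyQR δ s T).Q * kappa2 T ≤ 1) :
    0 < sigmaMin (flSCholeskyQR δ s T).Q ∧
      8 * pRatio (flSCholeskyQR δ s T).Q * kappa2 (flSCholeskyQR δ s T).Q *
        √(lam * √m * n * u + lam * √(n + 1) * n * u) ≤ 1 := by
  have hg : 0 < gNorm T := hσ.trans_le (sigmaMin_le_gNorm h.one_le T)
  set α := lam * √m * n * u + lam * √(n + 1) * n * u with hαdef
  set Q := (flSCholeskyQR δ s T).Q with hQ
  set p₁ := pRatio T with hp₁
  set p₂ := pRatio Q
  have hα : 0 < α := h.alpha_pos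
  have hα1 : α ≤ 1 / 1100 := h.alpha_le
  have hp1 : 0 ≤ p₁ := pRatio_nonneg T
  have hp2 : 0 ≤ p₂ := pRatio_nonneg Q
  have hp2' : p₂ ≤ 1 := pRatio_le_one Q
  have hk : 0 ≤ kappa2 T := kappa2_nonneg T
  have hβ : lam * √n * n * u ≤ α := by
    have h1 := h.sqrt_n_le
    have : 0 ≤ lam * √m * n * u := by have := h.lam_pos; have := h.u_pos; positivity
    linarith
  have hX : α * p₁ * p₂ * kappa2 T ≤ 1 / 86 := by linarith
  have hX0 : 0 ≤ α * p₁ * p₂ * kappa2 T := by positivity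
  obtain ⟨h1, h2⟩ := kappa2_flSCholeskyQR_le h hδ hσ hs rfl (by
    rw [← hQ, ← hp₁]
    have h3 : (lam * √n * n * u) * (p₁ * p₂ * kappa2 T) ≤ α * (p₁ * p₂ * kappa2 T) :=
      mul_le_mul_of_nonneg_right hβ (by positivity)
    linarith)
  refine ⟨h1, ?_⟩
  have ht : s / norm2 T ^ 2 * kappa2 T ^ 2 = 11 * α * p₁ ^ 2 * kappa2 T ^ 2 := by
    rw [hs, hp₁, pRatio]; ring
  rw [ht] at h2
  refine abs_le_of_sq_le_sq' ?_ zero_le_one |>.2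
  have h3 : 8 * p₂ * kappa2 Q * √α ≤
      8 * p₂ * (1.73 * √(1 + 11 * α * p₁ ^ 2 * kappa2 T ^ 2)) * √α := by
    gcongr
  have hkQ := kappa2_nonneg Q
  refine (pow_le_pow_left₀ (by positivity) h3 2).trans ?_
  have h4 : (8 * p₂ * (1.73 * √(1 + 11 * α * p₁ ^ 2 * kappa2 T ^ 2)) * √α) ^ 2 =
      (8 * 1.73) ^ 2 * (p₂ ^ 2 * α + 11 * (α * p₁ * p₂ * kappa2 T) ^ 2) := by
    rw [mul_pow _ (√α), mul_pow (8 * p₂), mul_pow 1.73, Real.sq_sqrt hα.le,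
      Real.sq_sqrt (by positivity)]
    ring
  rw [h4]
  have h5 : (α * p₁ * p₂ * kappa2 T) ^ 2 ≤ (1 / 86) ^ 2 := pow_le_pow_left₀ hX0 hX 2
  have h6 : p₂ ^ 2 * α ≤ 1 * α := mul_le_mul_of_nonneg_right (pow_le_one₀ hp2 hp2') hα.le
  linarith

/-- The two sweeps of CholeskyQR after a successful first sweep complete. -/
theorem flSCholeskyQR3_completes (h : RoundingSetting m n u lam)
    (hδ : SmallRunErrors δ u lam m n) (hc : (flSCholeskyQR δ s T).completes)
    (hσ : 0 < sigmaMin (flSCholeskyQR δ s T).Q)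
    (hcond : 8 * pRatio (flSCholeskyQR δ s T).Q * kappa2 (flSCholeskyQR δ s T).Q *
        √(lam * √m * n * u + lam * √(n + 1) * n * u) ≤ 1) :
    (flSCholeskyQR3 δ s T).completes := by
  set Q := (flSCholeskyQR δ s T).Q with hQ
  have hα : 0 < lam * √m * n * u + lam * √(n + 1) * n * u := h.alpha_pos
  have hα1 := h.alpha_le
  have hg : 0 < gNorm Q := hσ.trans_le (sigmaMin_le_gNorm h.one_le Q)
  have hσ2 : 64 * (lam * √m * n * u + lam * √(n + 1) * n * u) * gNorm Q ^ 2 ≤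
      sigmaMin Q ^ 2 := by
    rw [mul_assoc 8, pRatio_mul_kappa2 hg, ← mul_div_assoc, div_mul_eq_mul_div,
      div_le_one hσ] at hcond
    have := pow_le_pow_left₀ (by positivity) hcond 2
    rw [mul_pow, mul_pow, Real.sq_sqrt hα.le] at this
    linarith
  obtain ⟨h1, hb1⟩ := flCholeskyQR_spec h (hδ.gram 4 (by simp)) (hδ.chol 5 (by simp))
    (hδ.solve 6 (by simp)) hg hσ2
  obtain ⟨hN1, hσ1⟩ := hb1.nearly_orthogonal h hg hσ2
  set Q₁ := (flCholeskyQR δ 4 Q).Q with hQ₁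
  have hg1 : 0 < gNorm Q₁ := (show (0 : ℝ) < 0.97 by norm_num).trans_le
    (hσ1.trans (sigmaMin_le_gNorm h.one_le Q₁))
  have h2 := (flCholeskyQR_spec (A := Q₁) h (hδ.gram 8 (by simp)) (hδ.chol 9 (by simp))
    (hδ.solve 10 (by simp)) hg1 (by
      have h3 : gNorm Q₁ ^ 2 ≤ 1.03 ^ 2 :=
        pow_le_pow_left₀ hg1.le ((gNorm_le_norm2 Q₁).trans hN1) 2
      have h4 : (0.97 : ℝ) ^ 2 ≤ sigmaMin Q₁ ^ 2 := pow_le_pow_left₀ (by norm_num) hσ1 2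
      nlinarith)).1
  exact ⟨hc, h1, h2⟩

end Run

/-! ### The probability that the rounding errors are small -/

instance : Countable FlOp := by
  let f : FlOp → ℕ × ℕ × ℕ × ℕ × ℕ := fun o => match o with
    | .mul a b c d => (0, a, b, c, d)
    | .add a b c d => (1, a, b, c, d)
    | .div a b c => (2, a, b, c, 0)
    | .sqrt a b => (3, a, b, 0, 0)
  refine Function.Injective.countable (f := f) fun x y hxy => ?_
  cases x <;> cases y <;> simp_all [f]

section Probability

variable {Ω : Type*} [MeasurableSpace Ω] {μ : Measure Ω} [IsProbabilityMeasure μ] {u lam : ℝ}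
  {δ : FlOp → Ω → ℝ}

lemma IsRoundingModel.hasSubgaussianMGF (hδ : IsRoundingModel μ u δ) (o : FlOp) :
    HasSubgaussianMGF (δ o) ((‖u - -u‖₊ / 2) ^ 2) μ :=
  hasSubgaussianMGF_of_mem_Icc_of_integral_eq_zero (hδ.measurable o).aemeasurable
    (by filter_upwards [hδ.bounded o] with ω hω using abs_le.1 hω) (hδ.mean_zero o)

/-- Hoeffding's inequality for the errors of consecutive additions. -/
lemma IsRoundingModel.measure_abs_sum_gt_le (hδ : IsRoundingModel μ u δ) (hu : 0 < u)
    (hlam : 0 ≤ lam) (step i j a b N : ℕ) (hN : b - a ≤ N) :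
    μ.real {ω | √2 * lam * √N * u < |∑ l ∈ Finset.Ico a b, δ (.add step i j l) ω|} ≤
      2 * Real.exp (-lam ^ 2) := by
  set ε := √2 * lam * √N * u with hε
  have hε0 : 0 ≤ ε := by positivity
  rcases Nat.eq_zero_or_pos (b - a) with h0 | hpos
  · have : Finset.Ico a b = ∅ := Finset.Ico_eq_empty_iff.2 (by omega)
    have hempty : {ω | ε < |∑ l ∈ Finset.Ico a b, δ (.add step i j l) ω|} = ∅ := by
      ext ω
      simp [this, hε0]
    rw [hempty, measureReal_empty]
    positivity
  have hinj : Function.Injective (fun l => FlOp.add step i j l) := fun l l' h => by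
    simpa using h
  have hind : iIndepFun (fun l => δ (.add step i j l)) μ := hδ.indep.precomp hinj
  have hc : ((∑ l ∈ Finset.Ico a b, (‖u - -u‖₊ / 2) ^ 2 : NNReal) : ℝ) = (b - a : ℕ) * u ^ 2 := by
    rw [Finset.sum_const, Nat.card_Ico]
    push_cast
    rw [nsmul_eq_mul, Real.norm_of_nonneg (by linarith)]
    ring
  have hexp : Real.exp (-ε ^ 2 / (2 * ((∑ l ∈ Finset.Ico a b, (‖u - -u‖₊ / 2) ^ 2 : NNReal) : ℝ)))
      ≤ Real.exp (-lam ^ 2) := by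
    refine Real.exp_le_exp.2 ?_
    have hb : (0 : ℝ) < (b - a : ℕ) := by exact_mod_cast hpos
    have hbN : ((b - a : ℕ) : ℝ) ≤ N := by exact_mod_cast hN
    rw [hc, div_le_iff₀ (by positivity), hε, mul_pow, mul_pow, mul_pow,
      Real.sq_sqrt (by positivity),
      Real.sq_sqrt (by positivity)]
    have := mul_le_mul_of_nonneg_right hbN (show 0 ≤ 2 * lam ^ 2 * u ^ 2 by positivity)
    linarith
  have h1 := HasSubgaussianMGF.measure_sum_ge_le_of_iIndepFun hind (s := Finset.Ico a b)
    (fun l _ => hδ.hasSubgaussianMGF (.add step i j l)) hε0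
  have hind' : iIndepFun (fun l => -δ (.add step i j l)) μ :=
    hind.comp (fun _ x => -x) fun _ => measurable_neg
  have h2 := HasSubgaussianMGF.measure_sum_ge_le_of_iIndepFun hind' (s := Finset.Ico a b)
    (fun l _ => (hδ.hasSubgaussianMGF (.add step i j l)).neg) hε0
  refine (measureReal_mono (s₂ := {ω | ε ≤ ∑ l ∈ Finset.Ico a b, δ (.add step i j l) ω} ∪
    {ω | ε ≤ ∑ l ∈ Finset.Ico a b, (-δ (.add step i j l)) ω}) fun ω hω => ?_).trans
      ((measureReal_union_le _ _).trans ?_)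
  · simp only [Set.mem_ofPred_eq] at hω
    rcases lt_abs.1 hω with h | h
    · exact Or.inl h.le
    · right
      simp only [Set.mem_ofPred_eq, Pi.neg_apply, Finset.sum_neg_distrib]
      exact h.le
  · linarith [h1.trans hexp, h2.trans hexp]

/-- The sums of consecutive errors of additions that enter the error analysis, given by the
step, the position of the entry, the two ends of the interval of terms, and the number of terms
that scales the bound. -/
def errorSums (m n : ℕ) : Finset (ℕ × ℕ × ℕ × ℕ × ℕ × ℕ) :=
  (({0, 4, 8} : Finset ℕ) ×ˢ Finset.range n ×ˢ Finset.range n ×ˢ Finset.Ico 1 m ×ˢ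
      ({m} : Finset ℕ) ×ˢ ({m - 1} : Finset ℕ)) ∪
    ((({2, 5, 9} : Finset ℕ) ×ˢ Finset.range n ×ˢ Finset.range n ×ˢ ({0} : Finset ℕ) ×ˢ
        Finset.Ico 1 n ×ˢ ({n - 1} : Finset ℕ)) ∪
      (({3, 6, 10} : Finset ℕ) ×ˢ Finset.range m ×ˢ Finset.range n ×ˢ ({0} : Finset ℕ) ×ˢ
        Finset.Ico 1 n ×ˢ ({n - 1} : Finset ℕ)))

lemma card_errorSums_le (m n : ℕ) : (errorSums m n).card ≤
    3 * (n * n * (m - 1) + n * n * (n - 1) + m * n * (n - 1)) := by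
  refine (Finset.card_union_le _ _).trans
    ((Nat.add_le_add_left (Finset.card_union_le _ _) _).trans ?_)
  simp only [Finset.card_product, Finset.card_range, Nat.card_Ico, Finset.card_singleton]
  have h1 : ({0, 4, 8} : Finset ℕ).card = 3 := rfl
  have h2 : ({2, 5, 9} : Finset ℕ).card = 3 := rfl
  have h3 : ({3, 6, 10} : Finset ℕ).card = 3 := rfl
  rw [h1, h2, h3]
  apply le_of_eq
  ring

lemma three_mul_add_le_two_mul_sq {m n : ℕ} (hn : 1 ≤ n) (hmn : n ≤ m) :
    3 * (n * n * (m - 1) + n * n * (n - 1) + m * n * (n - 1)) ≤ 2 * (m * n ^ 2) ^ 2 := by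
  obtain ⟨k, rfl⟩ : ∃ k, m = k + 1 := ⟨m - 1, by omega⟩
  obtain ⟨l, rfl⟩ : ∃ l, n = l + 1 := ⟨n - 1, by omega⟩
  simp only [Nat.add_sub_cancel]
  rcases Nat.eq_zero_or_pos l with rfl | hl
  · nlinarith [sq_nonneg ((k : ℤ) - 1)]
  · have h1 : (l + 1) * (l + 1) * k ≤ (k + 1) * (l + 1) ^ 2 := by nlinarith
    have h2 : (l + 1) * (l + 1) * l ≤ (k + 1) * (l + 1) ^ 2 := by nlinarith [Nat.zero_le (l*l)]
    have h3 : (k + 1) * (l + 1) * l ≤ (k + 1) * (l + 1) ^ 2 := by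
      nlinarith [Nat.zero_le (k * l), Nat.zero_le k]
    have h4 : 2 * 2 ^ 2 ≤ (k + 1) * (l + 1) ^ 2 :=
      Nat.mul_le_mul (by omega) (Nat.pow_le_pow_left (by omega) 2)
    nlinarith

/-- The rounding errors of a run are small on an event whose complement has at most the
probability of one two-sided tail per element of `errorSums`. -/
lemma IsRoundingModel.exists_smallRunErrors (hδ : IsRoundingModel μ u δ) (hu : 0 < u)
    (hlam : 0 ≤ lam) {m n : ℕ} (hn : 1 ≤ n) (hmn : n ≤ m) :
    ∃ E : Set Ω, MeasurableSet E ∧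
      1 - (errorSums m n).card * (2 * Real.exp (-lam ^ 2)) ≤ μ.real E ∧
      ∀ ω ∈ E, SmallRunErrors (fun o => δ o ω) u lam m n := by
  set B : Set Ω := {ω | ∀ o, |δ o ω| ≤ u} with hB
  have hBmeas : MeasurableSet B := by
    rw [hB, Set.ofPred_forall]
    exact MeasurableSet.iInter fun o => measurableSet_le (hδ.measurable o).abs measurable_const
  have hBae : μ Bᶜ = 0 := (ae_all_iff.2 hδ.bounded : ∀ᵐ ω ∂μ, ∀ o, |δ o ω| ≤ u)
  set F : ℕ × ℕ × ℕ × ℕ × ℕ × ℕ → Set Ω := fun q => {ω | √2 * lam * √(q.2.2.2.2.2 : ℝ) * u <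
    |∑ l ∈ Finset.Ico q.2.2.2.1 q.2.2.2.2.1, δ (.add q.1 q.2.1 q.2.2.1 l) ω|} with hF
  have hFmeas : ∀ q, MeasurableSet (F q) := fun q =>
    measurableSet_lt measurable_const
      (Finset.measurable_fun_sum _ fun l _ => hδ.measurable _).abs
  have hFprob : ∀ q ∈ errorSums m n, μ.real (F q) ≤ 2 * Real.exp (-lam ^ 2) := by
    rintro ⟨st, i, j, a, b, N⟩ hq
    refine hδ.measure_abs_sum_gt_le hu hlam st i j a b N ?_
    simp only [errorSums, Finset.mem_union, Finset.mem_product, Finset.mem_singleton,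
      Finset.mem_Ico] at hq
    omega
  set D : Set Ω := Bᶜ ∪ ⋃ q ∈ errorSums m n, F q with hD
  have hDmeas : MeasurableSet D :=
    hBmeas.compl.union (Finset.measurableSet_biUnion _ fun q _ => hFmeas q)
  have hDprob : μ.real D ≤ (errorSums m n).card * (2 * Real.exp (-lam ^ 2)) := by
    refine (measureReal_union_le _ _).trans ?_
    have h1 : μ.real Bᶜ = 0 := by rw [measureReal_def, hBae]; rfl
    rw [h1, zero_add]
    refine (measureReal_biUnion_finset_le _ _).trans ?_
    refine (Finset.sum_le_sum hFprob).trans ?_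
    rw [Finset.sum_const, nsmul_eq_mul]
  refine ⟨Dᶜ, hDmeas.compl, ?_, fun ω hω => ?_⟩
  · rw [probReal_compl_eq_one_sub hDmeas]
    linarith
  · have hω' : ω ∈ B ∧ ∀ q ∈ errorSums m n, ω ∉ F q := by
      simpa [hD] using hω
    obtain ⟨hωB, hωF⟩ := hω'
    have hτ : ∀ N : ℕ, 1 ≤ N → √((N - 1 : ℕ) : ℝ) = √((N : ℝ) - 1) := fun N hN => by
      rw [Nat.cast_sub hN, Nat.cast_one]
    have hpre : ∀ st i j k : ℕ, (k ≠ 0 → (st, i, j, 0, k, n - 1) ∈ errorSums m n) →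
        |∑ l ∈ Finset.range k, δ (.add st i j l) ω| ≤ √2 * lam * √((n : ℝ) - 1) * u := by
      intro st i j k hq
      rcases eq_or_ne k 0 with rfl | hk
      · simp only [Finset.range_zero, Finset.sum_empty, abs_zero]
        positivity
      · have := hωF _ (hq hk)
        simp only [hF, Set.mem_ofPred_eq, not_lt, hτ n hn, ← Finset.range_eq_Ico] at this
        exact this
    refine ⟨fun st hst => ⟨hωB, fun i hi j hj a ha => ?_⟩,
      fun st hst => ⟨hωB, fun i hi j hj k hk => hpre st i j k fun hk0 => ?_⟩,
      fun st hst => ⟨hωB, fun i hi j hj k hk => hpre st i j k fun hk0 => ?_⟩⟩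
    · rcases le_or_gt m a with ham | ham
      · rw [Finset.Ico_eq_empty_iff.2 (by omega)]
        simp only [Finset.sum_empty, abs_zero]
        positivity
      · have := hωF (st, i, j, a, m, m - 1) (by
          refine Finset.mem_union_left _ ?_
          simp only [Finset.mem_product, Finset.mem_range, Finset.mem_Ico, Finset.mem_singleton,
            and_true]
          exact ⟨hst, hi, hj, ha, ham⟩)
        simp only [hF, Set.mem_ofPred_eq, not_lt, hτ m (hn.trans hmn)] at this
        exact this
    · refine Finset.mem_union_right _ (Finset.mem_union_left _ ?_)
      simp only [Finset.mem_product, Finset.mem_range, Finset.mem_Ico, Finset.mem_singleton,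
        and_true, true_and]
      exact ⟨hst, hi, hj, by omega, hk⟩
    · refine Finset.mem_union_right _ (Finset.mem_union_right _ ?_)
      simp only [Finset.mem_product, Finset.mem_range, Finset.mem_Ico, Finset.mem_singleton,
        and_true, true_and]
      exact ⟨hst, hi, hj, by omega, hk⟩

lemma one_sub_probP (u lam : ℝ) :
    1 - probP u lam = 2 * Real.exp (-(lam ^ 2 * (1 - u) ^ 2) / 2) := by
  rw [probP]; ring

lemma probQ_le_one {N : ℝ} (hN : 0 ≤ N) : probQ u lam N ≤ 1 := by
  rw [probQ, one_sub_probP]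
  have : 0 ≤ N * (2 * Real.exp (-(lam ^ 2 * (1 - u) ^ 2) / 2)) := by positivity
  linarith

/-- Positivity of the probability bound forces `λ² > 2 log 2`. -/
lemma lam_sq_ge_of_probQ_pos {N : ℝ} (hN : 1 ≤ N) (hu : 0 ≤ u) (hu1 : u ≤ 1)
    (hQ : 0 < probQ u lam N) : 1.386 ≤ lam ^ 2 := by
  rw [probQ, one_sub_probP] at hQ
  have h1 : Real.exp (-(lam ^ 2 * (1 - u) ^ 2) / 2) < 1 / 2 := by
    nlinarith [Real.exp_pos (-(lam ^ 2 * (1 - u) ^ 2) / 2)]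
  have h2 : Real.exp (-(lam ^ 2 * (1 - u) ^ 2) / 2) < Real.exp (-Real.log 2) := by
    rw [Real.exp_neg, Real.exp_log two_pos]
    linarith
  have h3 := Real.exp_lt_exp.1 h2
  have h4 : lam ^ 2 * (1 - u) ^ 2 ≤ lam ^ 2 * 1 :=
    mul_le_mul_of_nonneg_left (by nlinarith) (sq_nonneg lam)
  linarith [Real.log_two_gt_d9]

/-- The union bound over `errorSums` is better than `Q(λ, m n²)`. The tails at the deviation
`√2 λ` are of the order of the square of `1 - P(λ)`, and `m n² (1 - P(λ)) < 1`. -/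
lemma probQ_le_one_sub_card_mul {m n : ℕ} (hn : 1 ≤ n) (hmn : n ≤ m) (hu : 0 ≤ u) (hu1 : u ≤ 1)
    (hQ : 0 < probQ u lam (m * n ^ 2)) :
    probQ u lam (m * n ^ 2) ≤ 1 - (errorSums m n).card * (2 * Real.exp (-lam ^ 2)) := by
  rw [probQ, one_sub_probP] at hQ ⊢
  set e := Real.exp (-(lam ^ 2 * (1 - u) ^ 2) / 2) with he
  have he0 : 0 < e := Real.exp_pos _
  have h1 : Real.exp (-lam ^ 2) ≤ e ^ 2 := by
    rw [he, ← Real.exp_nat_mul]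
    refine Real.exp_le_exp.2 ?_
    have h4 : lam ^ 2 * (1 - u) ^ 2 ≤ lam ^ 2 * 1 :=
      mul_le_mul_of_nonneg_left (by nlinarith) (sq_nonneg lam)
    push_cast
    linarith
  have h2 : ((errorSums m n).card : ℝ) ≤ 2 * (m * n ^ 2) ^ 2 := by
    exact_mod_cast (card_errorSums_le m n).trans (three_mul_add_le_two_mul_sq hn hmn)
  set K : ℝ := m * n ^ 2
  have hK : 0 ≤ K := by positivity
  have h3 : ((errorSums m n).card : ℝ) * (2 * Real.exp (-lam ^ 2)) ≤ 2 * K ^ 2 * (2 * e ^ 2) :=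
    mul_le_mul h2 (by linarith) (by positivity) (by positivity)
  have h4 : K * (2 * e) * (K * (2 * e)) ≤ K * (2 * e) * 1 :=
    mul_le_mul_of_nonneg_left (by linarith) (by positivity)
  linarith

end Probability

/-! ### The condition numbers in Shifted CholeskyQR -/

theorem theorem4p5 {Ω : Type*} [MeasurableSpace Ω] (μ : Measure Ω) [IsProbabilityMeasure μ]
    (m n : ℕ) (hn : 1 ≤ n) (u lam : ℝ) (hu : 0 < u) (hlam_pos : 0 < lam) (hlam_le : lam ≤ 10)
    -- the general settings on the sizes
    (hsize₁ : max (lam * √m * n * u) (m * n * u) ≤ 1 / 2200)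
    (hsize₂ : max (lam * √(n + 1) * n * u) (n * (n + 1) * u) ≤ 1 / 2200)
    -- the factors of the probability bound are positive
    (hQ₁ : 0 < probQ u lam (m * n ^ 2))
    (hQ₂ : 0 < probQ u lam (n ^ 3 / 6 + n ^ 2 / 2 + n / 3))
    (hQ₃ : 0 < probQ u lam (n * (n + 1) / 2))
    (δ : FlOp → Ω → ℝ) (hδ : IsRoundingModel μ u δ)
    (T : Matrix (Fin m) (Fin n) ℝ) (hT : T.rank = n)
    (S s t : ℝ) (hS : S = √m * n * u + √(n + 1) * n * u)
    (hs : s = 11 * lam * S * gNorm T ^ 2) (ht : t = s / norm2 T ^ 2) :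
    t = 11 * pRatio T ^ 2 * lam * S ∧
    ∃ E : Set Ω, MeasurableSet E ∧
      (probQ u lam (m * n ^ 2) * probQ u lam (n ^ 3 / 6 + n ^ 2 / 2 + n / 3)) ^ 2 *
          probQ u lam (n * (n + 1) / 2) ≤ μ.real E ∧
      ∀ ω ∈ E,
        let δω : FlOp → ℝ := fun o => δ o ω
        let Q := (flSCholeskyQR δω s T).Q
        let p₁ := pRatio T
        let p₂ := pRatio Q
        (flSCholeskyQR δω s T).completes ∧
        -- the relationship between the condition numbers
        (4.89 * p₁ * p₂ * lam * n * √n * u * kappa2 T ≤ 1 →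
          Q.rank = n ∧
          kappa2 Q ≤ 3.24 * √(1 + t * kappa2 T ^ 2) ∧
          (1 ≤ t * kappa2 T ^ 2 → kappa2 Q ≤ 3.24 * √t * kappa2 T)) ∧
        -- the sufficient condition for Shifted CholeskyQR3
        1 / (86 * lam * p₁ * p₂ * S) ≤ 1 / (4.89 * lam * p₁ * p₂ * n * √n * u) ∧
        (kappa2 T ≤ 1 / (86 * lam * p₁ * p₂ * S) →
          Q.rank = n ∧
          8 * p₂ * kappa2 Q * √(lam * S) ≤ 1 ∧
          (flSCholeskyQR3 δω s T).completes) := by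
  have hnm : n ≤ m := hT ▸ T.rank_le_height
  have hn1 : (1 : ℝ) ≤ n := by exact_mod_cast hn
  have hm1 : (1 : ℝ) ≤ m := by exact_mod_cast hn.trans hnm
  have hu1 : u ≤ 1 := by
    have h1 := (le_max_right _ _).trans hsize₂
    have h2 : 1 * u ≤ n * (n + 1) * u := mul_le_mul_of_nonneg_right (by nlinarith) hu.le
    linarith
  have h : RoundingSetting m n u lam :=
    { one_le := hn
      le := hnm
      u_pos := hu
      lam_pos := hlam_pos
      lam_sq := lam_sq_ge_of_probQ_pos
        (one_le_mul_of_one_le_of_one_le hm1 (one_le_pow₀ hn1)) hu.le hu1 hQ₁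
      size_m := (le_max_left _ _).trans hsize₁
      size_mn := (le_max_right _ _).trans hsize₁
      size_n := (le_max_left _ _).trans hsize₂
      size_nn := (le_max_right _ _).trans hsize₂ }
  have hσ : 0 < sigmaMin T := (rank_eq_iff_sigmaMin_pos hn T).1 hT
  have hg : 0 < gNorm T := hσ.trans_le (sigmaMin_le_gNorm hn T)
  have hα : lam * √m * n * u + lam * √(n + 1) * n * u = lam * S := by rw [hS]; ring
  have hs' : s = 11 * (lam * √m * n * u + lam * √(n + 1) * n * u) * gNorm T ^ 2 := by
    rw [hα, hs]; ring
  have ht' : t = 11 * pRatio T ^ 2 * lam * S := by rw [ht, hs, pRatio]; ring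
  have hSpos : 0 < S := by rw [hS]; positivity
  obtain ⟨E, hE, hprob, hgood⟩ := hδ.exists_smallRunErrors hu hlam_pos.le hn hnm
  refine ⟨ht', E, hE, ?_, fun ω hω => ?_⟩
  · refine le_trans ?_ ((probQ_le_one_sub_card_mul hn hnm hu.le hu1 hQ₁).trans hprob)
    have hQ₁' : probQ u lam (m * n ^ 2) ≤ 1 := probQ_le_one (by positivity)
    have hQ₂' : probQ u lam (n ^ 3 / 6 + n ^ 2 / 2 + n / 3) ≤ 1 := probQ_le_one (by positivity)
    have hQ₃' : probQ u lam (n * (n + 1) / 2) ≤ 1 := probQ_le_one (by positivity)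
    set q₁ := probQ u lam (m * n ^ 2)
    set q₂ := probQ u lam (n ^ 3 / 6 + n ^ 2 / 2 + n / 3)
    calc (q₁ * q₂) ^ 2 * probQ u lam (n * (n + 1) / 2) ≤ (q₁ * q₂) ^ 2 :=
          mul_le_of_le_one_right (sq_nonneg _) hQ₃'
      _ ≤ q₁ * q₂ := pow_le_of_le_one (by positivity)
          (mul_le_one₀ hQ₁' hQ₂.le hQ₂') two_ne_zero
      _ ≤ q₁ := mul_le_of_le_one_right hQ₁.le hQ₂'
  have hδω := hgood ω hω
  intro δω Q p₁ p₂
  have hp₁ : 0 ≤ p₁ := pRatio_nonneg T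
  have hp₂ : 0 ≤ p₂ := pRatio_nonneg Q
  have hcompl : (flSCholeskyQR δω s T).completes :=
    (flSCholeskyQR_spec h (hδω.gram 0 (by simp)) (hδω.chol 2 (by simp))
      (hδω.solve 3 (by simp)) hg hs').1
  have hκ := kappa2_nonneg T
  have htκ : 0 ≤ t * kappa2 T ^ 2 := by rw [ht']; positivity
  refine ⟨hcompl, fun hcond => ?_, ?_, fun hcond => ?_⟩
  · obtain ⟨hσQ, hκQ⟩ := kappa2_flSCholeskyQR_le h hδω hσ hs' ht hcond
    refine ⟨(rank_eq_iff_sigmaMin_pos hn Q).2 hσQ, hκQ.trans ?_, fun hill => hκQ.trans ?_⟩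
    · exact mul_le_mul_of_nonneg_right (by norm_num) (Real.sqrt_nonneg _)
    · -- `1 + x ≤ 2 x` for `x = t κ₂(T)²`, and `1.73 √2 ≤ 3.24`
      refine abs_le_of_sq_le_sq' ?_ (by positivity) |>.2
      have ht0 : 0 ≤ t := by rw [ht']; positivity
      rw [mul_pow, mul_pow, mul_pow, Real.sq_sqrt (by linarith), Real.sq_sqrt ht0]
      linarith
  · rcases (mul_nonneg hp₁ hp₂).eq_or_lt with h0 | hpos
    · rw [show 86 * lam * p₁ * p₂ * S = 86 * lam * S * (p₁ * p₂) by ring,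
        show 4.89 * lam * p₁ * p₂ * n * √n * u = 4.89 * lam * n * √n * u * (p₁ * p₂) by ring,
        ← h0]
      simp
    · have h1 : 0 < n * √n * u := by positivity
      have h2 : n * √n * u ≤ S := by
        have h3 := h.sqrt_n_le
        have h4 : 0 ≤ lam * √m * n * u := by positivity
        refine le_of_mul_le_mul_left ?_ hlam_pos
        rw [← hα]
        linarith
      refine one_div_le_one_div_of_le ?_ ?_
      · rw [show 4.89 * lam * p₁ * p₂ * n * √n * u = 4.89 * lam * (p₁ * p₂) * (n * √n * u) by ring]
        positivity
      · rw [show 86 * lam * p₁ * p₂ * S = lam * (p₁ * p₂) * (86 * S) by ring,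
          show 4.89 * lam * p₁ * p₂ * n * √n * u =
            lam * (p₁ * p₂) * (4.89 * (n * √n * u)) by ring]
        exact mul_le_mul_of_nonneg_left (by linarith) (by positivity)
  · -- the hypothesis in product form, which is also true if `p₁ p₂ = 0`
    have hprod : 86 * (lam * √m * n * u + lam * √(n + 1) * n * u) * p₁ * p₂ * kappa2 T ≤ 1 := by
      have h1 : 0 ≤ 86 * lam * p₁ * p₂ * S := by positivity
      calc _ = 86 * lam * p₁ * p₂ * S * kappa2 T := by rw [hα]; ring
        _ ≤ 86 * lam * p₁ * p₂ * S * (1 / (86 * lam * p₁ * p₂ * S)) :=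
            mul_le_mul_of_nonneg_left hcond h1
        _ ≤ 1 := by rw [mul_one_div]; exact div_self_le_one _
    obtain ⟨hσQ, hcond2⟩ := cholesky2_condition h hδω hσ hs' hprod
    refine ⟨(rank_eq_iff_sigmaMin_pos hn Q).2 hσQ, ?_,
      flSCholeskyQR3_completes h hδω hcompl hσQ hcond2⟩
    rw [hα] at hcond2
    exact hcond2
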